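/- **Setting.** Let $\mathbb T^3=(-\pi,\pi]^3$ with Lebesgue measure, and for $s\in\mathbb Z^3$ put $|s|=|s^{(1)}|+|s^{(2)}|+|s^{(3)}|$. For $\alpha=1,2,3$ let $\hat\varepsilon_\alpha:\mathbb Z^3\to\mathbb R$ be such that (i) $\hat\varepsilon_\alpha(s)$ depends only on $|s|$; (ii) $|\hat\varepsilon_\alpha(s)|\le C e^{-a|s|}$ for some $a,C>0$ and all $s$; (iii) $\hat\varepsilon_\alpha(s)<0$ for $|s|=1$ and $\hat\varepsilon_\alpha(s)\le 0$ for $|s|>1$. For $\beta\gamma=12,23,31$ let $\hat v_{\beta\gamma}:\mathbb Z^3\to[0,\infty)$ be even with $\lim_{|s|\to\infty}|s|^{3+\kappa}\hat v_{\beta\gamma}(s)=0$ for some $\kappa>0$. For a cyclic permutation $\alpha\beta\gamma$ of $123$ put $$\varepsilon_\alpha(k)=\sum_{s\in\mathbb Z^3}\hat\varepsilon_\alpha(s)e^{i(k,s)},\qquad v_\alpha(k)=(2\pi)^{-3/2}\sum_{s\in\mathbb Z^3}\hat v_{\beta\gamma}(s)e^{i(k,s)},$$ $$m_\alpha=3\Big(-\sum_{s}\big[(s^{(1)})^2+(s^{(2)})^2+(s^{(3)})^2\big]\hat\varepsilon_\alpha(s)\Big)^{-1},\qquad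 l_{\gamma\beta}=\frac{m_\beta}{m_\beta+m_\gamma},\quad l_{\beta\gamma}=\frac{m_\gamma}{m_\beta+m_\gamma},$$ $$E^{(\alpha)}_k(q)=\varepsilon_\beta(l_{\gamma\beta}k+q)+\varepsilon_\gamma(l_{\beta\gamma}k-q),\qquad E^{(\alpha)}_{\min}(k)=\min_{q\in\mathbb T^3}E^{(\alpha)}_k(q).$$ On $L_2(\mathbb T^3)$ let $$(h_\alpha(k)f)(q)=E^{(\alpha)}_k(q)f(q)-(2\pi)^{-3/2}\int_{\mathbb T^3}v_\alpha(q-q')f(q')\,dq',$$ and for $z\le E^{(\alpha)}_{\min}(k)$ let $G_\alpha(k,z)$ be the integral operator with kernel $$G_\alpha(k,z;p,q)=(2\pi)^{-3/2}\frac{v_\alpha(p-q)}{(E^{(\alpha)}_k(p)-z)^{1/2}(E^{(\alpha)}_k(q)-z)^{1/2}}.$$ Let $N(k,z)\in\{0,1,\dots,\infty\}$ be the number of eigenvalues of $h_\alpha(k)$ strictly below $z$, counted with multiplicity. For a bounded self-adjoint operator $A$ let $n(\lambda,A)\in\{0,1,\dots,\infty\}$ be the supremum of the dimensions of the linear subspaces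 $L$ with $(Af,f)>\lambda(f,f)$ for all nonzero $f\in L$. **Theorem 5.4.** For each $\alpha\in\{1,2,3\}$ there is $\delta>0$ such that for every $k\in\mathbb T^3$ with $|k|<\delta$ (Euclidean norm): 1. for every $z\le E^{(\alpha)}_{\min}(k)$, $G_\alpha(k,z)$ is a well-defined bounded operator on $L_2(\mathbb T^3)$, it is positive (that is, self-adjoint with $(G_\alpha(k,z)f,f)\ge0$ for all $f$), and it is of Hilbert–Schmidt class; 2. $z\mapsto G_\alpha(k,z)$ is continuous on $(-\infty,E^{(\alpha)}_{\min}(k)]$, in the Hilbert–Schmidt norm and hence in the operator norm; 3. for every $z\le E^{(\alpha)}_{\min}(k)$, including $z=E^{(\alpha)}_{\min}(k)$, $$N(k,z)=n(1,G_\alpha(k,z)).$$ -/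

import Mathlib

open MeasureTheory Filter Topology
open scoped ENNReal

noncomputable section

namespace LatticeSchrodinger

/-! ### The lattice, the torus and the hypotheses on the data -/

/-- Points of the lattice `ℤ³`. -/
abbrev Site : Type := Fin 3 → ℤ

/-- Momenta, as vectors of `ℝ³`.  All symbols below are `2π`-periodic in each coordinate, so that
arithmetic modulo `2π` is automatic. -/
abbrev Momentum : Type := Fin 3 → ℝ

/-- `|s| = |s¹| + |s²| + |s³|`. -/
def siteNorm (s : Site) : ℝ := ∑ i, |(s i : ℝ)|

/-- `(k, s) = ∑ⱼ kʲ sʲ`. -/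
def pairing (k : Momentum) (s : Site) : ℝ := ∑ i, k i * (s i : ℝ)

/-- The torus `𝕋³ = (-π, π]³`. -/
def torus : Set Momentum := Set.univ.pi fun _ => Set.Ioc (-Real.pi) Real.pi

/-- Lebesgue measure on `𝕋³` (total mass `(2π)³`). -/
def torusMeasure : Measure Momentum := volume.restrict torus

/-- The Hilbert space `L₂(𝕋³)`. -/
abbrev L2Torus : Type := Lp ℂ 2 torusMeasure

/-- The conditions on a dispersion function: it depends only on `|s|`, decays exponentially, is
negative for `|s| = 1` and nonpositive for `|s| > 1`. -/
structure IsDispersion (e : Site → ℝ) : Prop where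
  radial : ∀ s t, siteNorm s = siteNorm t → e s = e t
  decay : ∃ a C : ℝ, 0 < a ∧ 0 < C ∧ ∀ s, |e s| ≤ C * Real.exp (-a * siteNorm s)
  neg : ∀ s, siteNorm s = 1 → e s < 0
  nonpos : ∀ s, 1 < siteNorm s → e s ≤ 0

/-- The conditions on a pair potential: it is nonnegative, even, and
`|s|^(3+κ) v̂(s) → 0` as `|s| → ∞`, for some `κ > 0`. -/
structure IsPairPotential (v : Site → ℝ) : Prop where
  nonneg : ∀ s, 0 ≤ v s
  even : ∀ s, v (-s) = v s
  decay : ∃ κ : ℝ, 0 < κ ∧ Tendsto (fun s => siteNorm s ^ (3 + κ) * v s) cofinite (𝓝 0)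

/-! ### Symbols -/

/-- The effective mass `m = 3 (-∑ₛ |s|₂² ε̂(s))⁻¹`. -/
def mass (e : Site → ℝ) : ℝ := 3 * (-∑' s, (∑ i, (s i : ℝ) ^ 2) * e s)⁻¹

/-- The Fourier series `∑ₛ c(s) e^{i(k,s)}`. -/
def fourierSeries (c : Site → ℝ) (k : Momentum) : ℂ :=
  ∑' s, (c s : ℂ) * Complex.exp (Complex.I * (pairing k s : ℂ))

/-- `ε(k) = ∑ₛ ε̂(s) e^{i(k,s)}`; the series is real because `ε̂` is even (see
`fourierSeries_im` below). -/
def dispersion (e : Site → ℝ) (k : Momentum) : ℝ := (fourierSeries e k).re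

/-- `v(k) = (2π)^{-3/2} ∑ₛ v̂(s) e^{i(k,s)}`. -/
def potential (v : Site → ℝ) (k : Momentum) : ℂ :=
  (((2 * Real.pi) ^ (-(3 / 2) : ℝ) : ℝ) : ℂ) * fourierSeries v k

lemma fourierSeries_im (c : Site → ℝ) (hc : ∀ s, c (-s) = c s) (k : Momentum) :
    (fourierSeries c k).im = 0 := by
  rw [← Complex.conj_eq_iff_im, fourierSeries, Complex.conj_tsum,
    ← (Equiv.neg Site).tsum_eq]
  refine tsum_congr fun s => ?_
  have hp : pairing k (-s) = -pairing k s := by simp [pairing]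
  simp [hc, hp, ← Complex.exp_conj]

/-- The two-particle symbol
`E_k^{(α)}(q) = ε_β(l_{γβ} k + q) + ε_γ(l_{βγ} k - q)`, where `(α, β, γ)` is the cyclic
permutation of the three particles starting at `α`, and
`l_{γβ} = m_β / (m_β + m_γ)`, `l_{βγ} = m_γ / (m_β + m_γ)`. -/
def pairEnergy (e : Fin 3 → Site → ℝ) (α : Fin 3) (k q : Momentum) : ℝ :=
  let mβ := mass (e (α + 1))
  let mγ := mass (e (α + 2))
  dispersion (e (α + 1)) ((mβ / (mβ + mγ)) • k + q) +
    dispersion (e (α + 2)) ((mγ / (mβ + mγ)) • k - q)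

/-- The threshold `E_min^{(α)}(k)`, the minimum of `E_k^{(α)}` over the torus (for the data
considered here the symbol is continuous and periodic, so the infimum is attained). -/
def thresholdEnergy (e : Fin 3 → Site → ℝ) (α : Fin 3) (k : Momentum) : ℝ :=
  sInf (pairEnergy e α k '' torus)

/-! ### Operators on `L₂(𝕋³)` -/

/-- `T` is the integral operator with kernel `K`: for every `f ∈ L₂(𝕋³)` and almost every `p` the
function `q ↦ K(p,q) f(q)` is integrable, and `(T f)(p) = ∫ K(p,q) f(q) dq`. -/
def HasKernel (T : L2Torus →L[ℂ] L2Torus) (K : Momentum → Momentum → ℂ) : Prop :=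
  ∀ f : L2Torus, ∀ᵐ p ∂torusMeasure,
    Integrable (fun q => K p q * f q) torusMeasure ∧ T f p = ∫ q, K p q * f q ∂torusMeasure

open Classical in
/-- The bounded operator on `L₂(𝕋³)` with kernel `K` (and `0` if there is none). -/
def integralOperator (K : Momentum → Momentum → ℂ) : L2Torus →L[ℂ] L2Torus :=
  if h : ∃ T, HasKernel T K then h.choose else 0

open Classical in
/-- Multiplication by the function `m` on `L₂(𝕋³)` (and `0` if `m` is not essentially bounded). -/
def multiplicationOperator (m : Momentum → ℂ) : L2Torus →L[ℂ] L2Torus :=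
  if h : MemLp m ∞ torusMeasure then
    (ContinuousLinearMap.mul ℂ ℂ).holderL torusMeasure ∞ 2 2 (h.toLp m)
  else 0

/-- The kernel `(2π)^{-3/2} v_α(q - q')` of the interaction operator. -/
def interactionKernel (v : Site → ℝ) (q q' : Momentum) : ℂ :=
  (((2 * Real.pi) ^ (-(3 / 2) : ℝ) : ℝ) : ℂ) * potential v (q - q')

/-- The two-particle operator `h_α(k) = h_α⁰(k) - v_α` on `L₂(𝕋³)`.  Here `v α` is the potential
`v̂_{βγ}` of the pair complementary to the particle `α`. -/
def twoParticleOperator (e v : Fin 3 → Site → ℝ) (α : Fin 3) (k : Momentum) :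
    L2Torus →L[ℂ] L2Torus :=
  multiplicationOperator (fun q => (pairEnergy e α k q : ℂ)) -
    integralOperator (interactionKernel (v α))

/-- The Birman-Schwinger kernel
`(2π)^{-3/2} v_α(p - q) / ((E_k(p) - z)^{1/2} (E_k(q) - z)^{1/2})`. -/
def birmanSchwingerKernel (e v : Fin 3 → Site → ℝ) (α : Fin 3) (k : Momentum) (z : ℝ)
    (p q : Momentum) : ℂ :=
  (((2 * Real.pi) ^ (-(3 / 2) : ℝ) : ℝ) : ℂ) * potential (v α) (p - q) /
    ((√(pairEnergy e α k p - z) * √(pairEnergy e α k q - z) : ℝ) : ℂ)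

/-- The operator `G_α(k,z)`. -/
def birmanSchwingerOperator (e v : Fin 3 → Site → ℝ) (α : Fin 3) (k : Momentum) (z : ℝ) :
    L2Torus →L[ℂ] L2Torus :=
  integralOperator (birmanSchwingerKernel e v α k z)

/-! ### Hilbert-Schmidt class and counting functions -/

section Abstract

variable {H : Type*} [NormedAddCommGroup H] [InnerProductSpace ℂ H]

/-- `∑ᵢ ‖T bᵢ‖²`, the square of the Hilbert-Schmidt norm of `T`, computed in the
orthonormal basis `b` (it does not depend on `b`). -/
def hsNormSq {ι : Type*} (b : HilbertBasis ι ℂ H) (T : H →L[ℂ] H) : ℝ≥0∞ :=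
  ∑' i, ‖T (b i)‖ₑ ^ 2

/-- The number of eigenvalues of `A` below `z`, counted with multiplicity: the dimension of the
(algebraically direct) sum of the eigenspaces for the eigenvalues `t < z`. -/
def eigenvalueCount (A : H →L[ℂ] H) (z : ℝ) : ℕ∞ :=
  Cardinal.toENat
    (Module.rank ℂ ↥(⨆ t : Set.Iio z, Module.End.eigenspace (A : Module.End ℂ H) ((t : ℝ) : ℂ)))

/-- `n(z, A)`: the supremum of the dimensions of the subspaces `L` such that
`(A f, f) > z (f, f)` for all nonzero `f ∈ L`. -/
def formCount (z : ℝ) (A : H →L[ℂ] H) : ℕ∞ :=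
  ⨆ L : {L : Submodule ℂ H // ∀ f ∈ L, f ≠ 0 → z * ‖f‖ ^ 2 < (inner ℂ (A f) f).re},
    Cardinal.toENat (Module.rank ℂ ↥L.1)

end Abstract

/-- `T` belongs to the Hilbert-Schmidt class `Σ₂`. -/
def IsHilbertSchmidt (T : L2Torus →L[ℂ] L2Torus) : Prop :=
  ∀ (ι : Type) (b : HilbertBasis ι ℂ L2Torus), hsNormSq b T < ∞

/-- `G` is continuous on `S` with respect to the Hilbert-Schmidt norm. -/
def HSContinuousOn (G : ℝ → L2Torus →L[ℂ] L2Torus) (S : Set ℝ) : Prop :=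
  ∀ (ι : Type) (b : HilbertBasis ι ℂ L2Torus), ∀ z₀ ∈ S,
    Tendsto (fun z => hsNormSq b (G z - G z₀)) (𝓝[S] z₀) (𝓝 0)

/-! ### The operators above are the intended ones

The two default values `0` in the definitions are not used for the two-particle operator. -/

instance : IsFiniteMeasure torusMeasure := by
  refine ⟨?_⟩
  rw [torusMeasure, Measure.restrict_apply_univ, torus, Real.volume_pi_Ioc]
  exact ENNReal.prod_lt_top fun _ _ => ENNReal.ofReal_lt_top

lemma summable_siteNorm_rpow {r : ℝ} (hr : 3 < r) : Summable fun s : Site => siteNorm s ^ (-r) := by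
  let b := Pi.basisFun ℝ (Fin 3)
  let L : Submodule ℤ (Fin 3 → ℝ) := Submodule.span ℤ (Set.range b)
  have hmem : ∀ s : Site, (fun i => (s i : ℝ)) ∈ L := by
    intro s
    have : (fun i => (s i : ℝ)) = ∑ i, s i • b i := by
      ext j
      simp [b, Finset.sum_apply, Pi.single_apply]
    rw [this]
    exact Submodule.sum_mem _ fun i _ =>
      Submodule.smul_mem _ _ (Submodule.subset_span (Set.mem_range_self i))
  let φ : Site → L := fun s => ⟨fun i => (s i : ℝ), hmem s⟩
  have hφ : Function.Injective φ := by
    intro s t hst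
    ext i
    have h : (s i : ℝ) = (t i : ℝ) := congrFun (congrArg Subtype.val hst) i
    exact_mod_cast h
  have hrank : Module.finrank ℤ L = 3 := by
    rw [ZLattice.rank ℝ L]
    simp
  have h := (ZLattice.summable_norm_rpow L (-r) (by rw [hrank]; push_cast; linarith)).comp_injective
    hφ
  refine h.of_norm_bounded_eventually ?_
  have h0 : ({0} : Set Site)ᶜ ∈ cofinite := (Set.finite_singleton (0 : Site)).compl_mem_cofinite
  filter_upwards [h0] with s hs
  have hle : ‖φ s‖ ≤ siteNorm s := by
    change ‖(fun i => (s i : ℝ))‖ ≤ _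
    refine (pi_norm_le_iff_of_nonneg (Finset.sum_nonneg fun _ _ => abs_nonneg _)).2 fun i => ?_
    exact Finset.single_le_sum (f := fun i => |(s i : ℝ)|) (fun _ _ => abs_nonneg _)
      (Finset.mem_univ i)
  have hpos : 0 < ‖φ s‖ := by
    rw [norm_pos_iff]
    intro h
    exact hs (hφ (h.trans (by ext i; simp [φ])))
  rw [Real.norm_of_nonneg (Real.rpow_nonneg (hpos.le.trans hle) _)]
  exact Real.rpow_le_rpow_of_nonpos hpos hle (by linarith)

lemma siteNorm_pos {s : Site} (hs : s ≠ 0) : 0 < siteNorm s := by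
  obtain ⟨i, hi⟩ := Function.ne_iff.1 hs
  refine Finset.sum_pos' (fun _ _ => abs_nonneg _) ⟨i, Finset.mem_univ i, ?_⟩
  simpa using hi

lemma ne_zero_mem_cofinite : {s : Site | s ≠ 0} ∈ (cofinite : Filter Site) :=
  (Set.finite_singleton (0 : Site)).compl_mem_cofinite

lemma IsDispersion.summable {e : Site → ℝ} (he : IsDispersion e) : Summable fun s => |e s| := by
  obtain ⟨a, C, ha, hC, h⟩ := he.decay
  refine ((summable_siteNorm_rpow (r := 4) (by norm_num)).mul_left
    (C * (24 / a ^ 4))).of_norm_bounded_eventually ?_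
  filter_upwards [ne_zero_mem_cofinite] with s hs
  have hp := siteNorm_pos hs
  rw [Real.norm_of_nonneg (abs_nonneg _)]
  refine (h s).trans ?_
  rw [mul_assoc]
  refine mul_le_mul_of_nonneg_left ?_ hC.le
  have h1 := Real.pow_div_factorial_le_exp (x := a * siteNorm s) (by positivity) 4
  have h2 : Real.exp (-a * siteNorm s) = (Real.exp (a * siteNorm s))⁻¹ := by
    rw [← Real.exp_neg]; ring_nf
  have h3 : siteNorm s ^ (-(4 : ℝ)) = (siteNorm s ^ 4)⁻¹ := by
    rw [Real.rpow_neg hp.le]; norm_cast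
  rw [h2, h3]
  calc (Real.exp (a * siteNorm s))⁻¹ ≤ ((a * siteNorm s) ^ 4 / (Nat.factorial 4 : ℝ))⁻¹ :=
        inv_anti₀ (by positivity) h1
    _ = 24 / a ^ 4 * (siteNorm s ^ 4)⁻¹ := by
        have : (Nat.factorial 4 : ℝ) = 24 := by norm_num [Nat.factorial]
        rw [this]
        field_simp

lemma IsPairPotential.summable {v : Site → ℝ} (hv : IsPairPotential v) :
    Summable fun s => |v s| := by
  obtain ⟨κ, hκ, h⟩ := hv.decay
  refine (summable_siteNorm_rpow (r := 3 + κ) (by linarith)).of_norm_bounded_eventually ?_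
  filter_upwards [ne_zero_mem_cofinite, h.eventually (gt_mem_nhds one_pos)] with s hs h1
  have hp := siteNorm_pos hs
  have hq : 0 < siteNorm s ^ (3 + κ) := Real.rpow_pos_of_pos hp _
  rw [Real.norm_of_nonneg (abs_nonneg _), abs_of_nonneg (hv.nonneg s), Real.rpow_neg hp.le,
    ← one_div, le_div_iff₀ hq, mul_comm]
  exact h1.le

lemma norm_fourierSeries_term (c : Site → ℝ) (s : Site) (k : Momentum) :
    ‖(c s : ℂ) * Complex.exp (Complex.I * (pairing k s : ℂ))‖ = |c s| := by
  rw [norm_mul, Complex.norm_real, mul_comm Complex.I, Complex.norm_exp_ofReal_mul_I, mul_one,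
    Real.norm_eq_abs]

lemma continuous_fourierSeries {c : Site → ℝ} (hc : Summable fun s => |c s|) :
    Continuous (fourierSeries c) := by
  refine continuous_tsum (fun s => ?_) hc fun s k => (norm_fourierSeries_term c s k).le
  unfold pairing
  fun_prop

lemma norm_fourierSeries_le {c : Site → ℝ} (hc : Summable fun s => |c s|) (k : Momentum) :
    ‖fourierSeries c k‖ ≤ ∑' s, |c s| :=
  tsum_of_norm_bounded hc.hasSum fun s => (norm_fourierSeries_term c s k).le

/-- A square integrable kernel defines a bounded operator. -/
lemma exists_integralOperator {X : Type*} [MeasurableSpace X] {μ : Measure X} [IsFiniteMeasure μ]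
    {K : X → X → ℂ} (hK : MemLp (Function.uncurry K) 2 (μ.prod μ)) :
    ∃ T : Lp ℂ 2 μ →L[ℂ] Lp ℂ 2 μ, ∀ f : Lp ℂ 2 μ, ∀ᵐ p ∂μ,
      Integrable (fun q => K p q * f q) μ ∧ T f p = ∫ q, K p q * f q ∂μ := by
  have hsq : ∀ {g : X → ℂ}, eLpNorm g 2 μ ^ 2 = ∫⁻ q, ‖g q‖ₑ ^ 2 ∂μ := fun {g} => by
    simpa using eLpNorm_nnreal_pow_eq_lintegral (μ := μ) (f := g) (p := 2) two_ne_zero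
  have hKm := hK.aestronglyMeasurable
  have hKsq : ∫⁻ p, eLpNorm (K p) 2 μ ^ 2 ∂μ =
      eLpNorm (Function.uncurry K) 2 (μ.prod μ) ^ 2 := by
    have h := eLpNorm_nnreal_pow_eq_lintegral (μ := μ.prod μ) (f := Function.uncurry K) (p := 2)
      two_ne_zero
    have h' : eLpNorm (Function.uncurry K) 2 (μ.prod μ) ^ 2 =
        ∫⁻ x, ‖Function.uncurry K x‖ₑ ^ 2 ∂(μ.prod μ) := by simpa using h
    rw [h', lintegral_prod _ (hKm.enorm.pow_const 2)]
    exact lintegral_congr fun p => hsq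
  have hKm' : ∀ᵐ p ∂μ, AEStronglyMeasurable (K p) μ := hKm.prodMk_left
  have hKmeas : AEMeasurable (fun p => eLpNorm (K p) 2 μ ^ 2) μ := by
    simp_rw [hsq]
    exact (hKm.enorm.pow_const 2).lintegral_prod_right'
  have hKfin : ∀ᵐ p ∂μ, MemLp (K p) 2 μ := by
    have h : ∀ᵐ p ∂μ, eLpNorm (K p) 2 μ ^ 2 < ∞ := by
      refine ae_lt_top' hKmeas ?_
      rw [hKsq]
      exact ENNReal.pow_ne_top hK.eLpNorm_ne_top
    filter_upwards [h, hKm'] with p h1 h2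
    exact ⟨h2, by simpa using h1⟩
  have hint : ∀ f : Lp ℂ 2 μ, ∀ᵐ p ∂μ, Integrable (fun q => K p q * f q) μ := fun f => by
    filter_upwards [hKfin] with p hp
    exact hp.integrable_mul (Lp.memLp f)
  have hbound : ∀ f : Lp ℂ 2 μ, ∀ᵐ p ∂μ,
      ‖∫ q, K p q * f q ∂μ‖ₑ ≤ eLpNorm (K p) 2 μ * eLpNorm f 2 μ := fun f => by
    filter_upwards [hKfin] with p hp
    refine (enorm_integral_le_lintegral_enorm _).trans ?_
    rw [← eLpNorm_one_eq_lintegral_enorm]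
    have h := eLpNorm_smul_le_mul_eLpNorm (p := 2) (q := 2) (r := 1)
      (Lp.aestronglyMeasurable f) hp.1
    exact h
  have hnorm : ∀ f : Lp ℂ 2 μ, eLpNorm (fun p => ∫ q, K p q * f q ∂μ) 2 μ ≤
      eLpNorm (Function.uncurry K) 2 (μ.prod μ) * eLpNorm f 2 μ := fun f => by
    rw [← ENNReal.pow_le_pow_left_iff two_ne_zero, hsq, mul_pow, ← hKsq,
      ← lintegral_mul_const'' _ hKmeas]
    refine lintegral_mono_ae ?_
    filter_upwards [hbound f] with p hp
    rw [← mul_pow]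
    gcongr
  have hmem : ∀ f : Lp ℂ 2 μ, MemLp (fun p => ∫ q, K p q * f q ∂μ) 2 μ := fun f => by
    refine ⟨?_, (hnorm f).trans_lt (ENNReal.mul_lt_top hK.eLpNorm_lt_top (Lp.eLpNorm_lt_top f))⟩
    have h : AEStronglyMeasurable (fun x : X × X => K x.1 x.2 * f x.2)
        (μ.prod μ) := hKm.mul (Lp.aestronglyMeasurable f).comp_snd
    exact AEStronglyMeasurable.integral_prod_right' (f := fun x : X × X => K x.1 x.2 * f x.2) h
  let T : Lp ℂ 2 μ →ₗ[ℂ] Lp ℂ 2 μ :=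
    { toFun := fun f => (hmem f).toLp _
      map_add' := fun f g => by
        rw [← MemLp.toLp_add]
        refine MemLp.toLp_congr _ _ ?_
        filter_upwards [hint f, hint g] with p h1 h2
        rw [Pi.add_apply, ← integral_add h1 h2]
        refine integral_congr_ae ?_
        filter_upwards [Lp.coeFn_add f g] with q hq
        rw [hq, Pi.add_apply, mul_add]
      map_smul' := fun c f => by
        rw [RingHom.id_apply, ← MemLp.toLp_const_smul]
        refine MemLp.toLp_congr _ _ (ae_of_all _ fun p => ?_)
        rw [Pi.smul_apply, ← integral_smul]
        refine integral_congr_ae ?_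
        filter_upwards [Lp.coeFn_smul c f] with q hq
        rw [hq, Pi.smul_apply, smul_eq_mul, smul_eq_mul]
        ring }
  refine ⟨T.mkContinuous (eLpNorm (Function.uncurry K) 2 (μ.prod μ)).toReal fun f => ?_,
    fun f => ?_⟩
  · rw [Lp.norm_def, Lp.norm_def, ← ENNReal.toReal_mul]
    refine ENNReal.toReal_mono (ENNReal.mul_ne_top hK.eLpNorm_ne_top (Lp.eLpNorm_ne_top f)) ?_
    exact (eLpNorm_congr_ae (hmem f).coeFn_toLp).trans_le (hnorm f)
  · filter_upwards [hint f, (hmem f).coeFn_toLp] with p h1 h2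
    exact ⟨h1, h2⟩

lemma exists_hasKernel {K : Momentum → Momentum → ℂ}
    (hK : MemLp (Function.uncurry K) 2 (torusMeasure.prod torusMeasure)) :
    ∃ T, HasKernel T K :=
  exists_integralOperator hK

lemma integralOperator_hasKernel {K : Momentum → Momentum → ℂ}
    (hK : MemLp (Function.uncurry K) 2 (torusMeasure.prod torusMeasure)) :
    HasKernel (integralOperator K) K := by
  have h := exists_hasKernel hK
  rw [integralOperator, dif_pos h]
  exact h.choose_spec

/-- A bounded operator is determined by its kernel. -/
lemma HasKernel.unique {K : Momentum → Momentum → ℂ} {S T : L2Torus →L[ℂ] L2Torus}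
    (hS : HasKernel S K) (hT : HasKernel T K) : S = T := by
  ext1 f
  refine Lp.ext ?_
  filter_upwards [hS f, hT f] with p h1 h2
  rw [h1.2, h2.2]

lemma multiplicationOperator_ae {m : Momentum → ℂ} (hm : MemLp m ∞ torusMeasure) (f : L2Torus) :
    multiplicationOperator m f =ᵐ[torusMeasure] fun q => m q * f q := by
  rw [multiplicationOperator, dif_pos hm]
  filter_upwards [(ContinuousLinearMap.mul ℂ ℂ).coeFn_holder (r := 2) (hm.toLp m) f,
    hm.coeFn_toLp] with q h1 h2
  simp only [ContinuousLinearMap.holderL_apply_apply]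
  rw [h1, h2]
  rfl

/-- `(h_α(k) f)(q) = E_k(q) f(q) - (2π)^{-3/2} ∫ v_α(q - q') f(q') dq'`. -/
lemma twoParticleOperator_ae {e v : Fin 3 → Site → ℝ} (he : ∀ α, IsDispersion (e α))
    (hv : ∀ α, IsPairPotential (v α)) (α : Fin 3) (k : Momentum) (f : L2Torus) :
    twoParticleOperator e v α k f =ᵐ[torusMeasure] fun q =>
      (pairEnergy e α k q : ℂ) * f q -
        ∫ q', interactionKernel (v α) q q' * f q' ∂torusMeasure := by
  have hE : MemLp (fun q => (pairEnergy e α k q : ℂ)) ∞ torusMeasure := by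
    have hb := fun α k => (Complex.abs_re_le_norm _).trans
      (norm_fourierSeries_le (he α).summable k)
    have h1 := (continuous_fourierSeries (he (α + 1)).summable)
    have h2 := (continuous_fourierSeries (he (α + 2)).summable)
    refine memLp_top_of_bound (Continuous.aestronglyMeasurable ?_)
      ((∑' s, |e (α + 1) s|) + ∑' s, |e (α + 2) s|) (ae_of_all _ fun q => ?_)
    · unfold pairEnergy dispersion
      fun_prop
    · rw [Complex.norm_real, Real.norm_eq_abs]
      exact (abs_add_le _ _).trans (add_le_add (hb _ _) (hb _ _))
  have hK : MemLp (Function.uncurry (interactionKernel (v α))) 2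
      (torusMeasure.prod torusMeasure) := by
    have h1 := (continuous_fourierSeries (hv α).summable)
    refine MemLp.of_bound (Continuous.aestronglyMeasurable ?_)
      (‖(((2 * Real.pi) ^ (-(3 / 2) : ℝ) : ℝ) : ℂ)‖ *
        (‖(((2 * Real.pi) ^ (-(3 / 2) : ℝ) : ℝ) : ℂ)‖ * ∑' s, |v α s|)) (ae_of_all _ fun x => ?_)
    · unfold interactionKernel potential Function.uncurry
      fun_prop
    · simp only [Function.uncurry, interactionKernel, potential, norm_mul]
      gcongr
      exact norm_fourierSeries_le (hv α).summable _
  rw [twoParticleOperator, sub_apply]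
  filter_upwards [Lp.coeFn_sub (multiplicationOperator (fun q => (pairEnergy e α k q : ℂ)) f)
      (integralOperator (interactionKernel (v α)) f), multiplicationOperator_ae hE f,
      integralOperator_hasKernel hK f] with q h1 h2 h3
  rw [h1, Pi.sub_apply, h2, h3.2]

end LatticeSchrodinger

end

noncomputable section

namespace LatticeSchrodinger

/-! ### Dispersion functions -/

/-! Write `B` for multiplication by the symbol `E`, `V` for the interaction, and `R` for
multiplication by `√(E - z)`. As quadratic forms, `B - V - z = R (1 - G) R`. For `z` at the bottom
of `E` the operator `R` has no bounded inverse, but it remains bounded, injective and of dense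
range, and this is all that the count needs (`eigenvalueCount_eq_formCount`). Let `W` be the span of
the eigenvectors of `B - V` below `z`. The image `R W` has the dimension of `W`, and `G > 1` on it.
Conversely, a space of larger dimension on which `G > 1` can be moved slightly into the range of
`R`. It then yields a vector orthogonal to `W` on which the form of `B - V` is below `z`. Since `V`
is compact, a minimizing sequence in the complement of `W` converges to an eigenvector below `z`,
which is absurd (`exists_eigenvector_of_form_lt`).

The analytic input is `exists_quadratic_lower_bound`: for small `k`, `E` exceeds its minimum by at
least `c ‖q - a‖²` on the torus. In dimension three `‖q - a‖⁻²` is integrable, so the weight `(E -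
z)^{-1/2}` is square integrable up to and including the threshold. As `v` is bounded, the kernel of
`G` is square integrable, which gives the Hilbert–Schmidt property; dominated convergence gives
continuity in `z`.

Positivity comes from `v̂ ≥ 0`: expanding `v(p - q)` in plane waves turns `G` into a norm-convergent
sum of nonnegative multiples of rank-one projections. The same expansion proves that `V` is compact
and identifies the forms of `V` and of `R G R`. -/

lemma siteNorm_nonneg (s : Site) : 0 ≤ siteNorm s :=
  Finset.sum_nonneg fun _ _ => abs_nonneg _

lemma one_le_siteNorm {s : Site} (hs : s ≠ 0) : 1 ≤ siteNorm s := by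
  obtain ⟨i, hi⟩ := Function.ne_iff.1 hs
  have h1 : (1 : ℤ) ≤ |s i| := Int.one_le_abs hi
  have h2 : |(s i : ℝ)| ≤ siteNorm s :=
    Finset.single_le_sum (f := fun i => |(s i : ℝ)|) (fun _ _ => abs_nonneg _) (Finset.mem_univ i)
  exact le_trans (by exact_mod_cast h1) h2

lemma siteNorm_zero : siteNorm 0 = 0 := by simp [siteNorm]

lemma siteNorm_single (i : Fin 3) : siteNorm (Pi.single i 1) = 1 := by
  unfold siteNorm
  rw [Finset.sum_eq_single i]
  · simp
  · intro j _ hj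
    simp [Pi.single_eq_of_ne hj]
  · simp

lemma pairing_single (k : Momentum) (i : Fin 3) : pairing k (Pi.single i 1) = k i := by
  unfold pairing
  rw [Finset.sum_eq_single i]
  · simp
  · intro j _ hj
    simp [Pi.single_eq_of_ne hj]
  · simp

lemma pairing_add (k l : Momentum) (s : Site) : pairing (k + l) s = pairing k s + pairing l s := by
  simp [pairing, add_mul, Finset.sum_add_distrib]

lemma pairing_sub (k l : Momentum) (s : Site) : pairing (k - l) s = pairing k s - pairing l s := by
  simp [pairing, sub_mul, Finset.sum_sub_distrib]

lemma pairing_neg (k : Momentum) (s : Site) : pairing (-k) s = -pairing k s := by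
  simp [pairing]

lemma abs_pairing_le (k : Momentum) (s : Site) : |pairing k s| ≤ ‖k‖ * siteNorm s := by
  unfold pairing siteNorm
  rw [Finset.mul_sum]
  refine (Finset.abs_sum_le_sum_abs _ _).trans (Finset.sum_le_sum fun i _ => ?_)
  rw [abs_mul]
  exact mul_le_mul_of_nonneg_right (norm_le_pi_norm k i) (abs_nonneg _)

lemma IsDispersion.nonpos_of_ne_zero {e : Site → ℝ} (he : IsDispersion e) {s : Site} (hs : s ≠ 0) :
    e s ≤ 0 := by
  rcases (one_le_siteNorm hs).eq_or_lt with h | h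
  · exact (he.neg s h.symm).le
  · exact he.nonpos s h

/-- The fourth moment controls the remainder in the second-difference bound, where `1 - cos (m, s)`
and `1 - cos (d, s)` each cost a factor `|s|²`. In the proof `exp (-x) ≤ 8! / x ^ 8`: four powers
absorb the weight and four are left for summability over `ℤ³`. -/
lemma IsDispersion.summable_mul_pow_four {e : Site → ℝ} (he : IsDispersion e) :
    Summable fun s => |e s| * siteNorm s ^ 4 := by
  obtain ⟨a, C, ha, hC, h⟩ := he.decay
  refine ((summable_siteNorm_rpow (r := 4) (by norm_num)).mul_left
    (C * (40320 / a ^ 8))).of_norm_bounded_eventually ?_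
  filter_upwards [ne_zero_mem_cofinite] with s hs
  have hp := siteNorm_pos hs
  rw [Real.norm_of_nonneg (by positivity)]
  have h1 := Real.pow_div_factorial_le_exp (x := a * siteNorm s) (by positivity) 8
  have h2 : Real.exp (-a * siteNorm s) = (Real.exp (a * siteNorm s))⁻¹ := by
    rw [← Real.exp_neg]; ring_nf
  have h3 : siteNorm s ^ (-(4 : ℝ)) = (siteNorm s ^ 4)⁻¹ := by
    rw [Real.rpow_neg hp.le]; norm_cast
  have h4 : (Real.exp (a * siteNorm s))⁻¹ ≤ ((a * siteNorm s) ^ 8 / (Nat.factorial 8 : ℝ))⁻¹ :=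
    inv_anti₀ (by positivity) h1
  have h5 : (Nat.factorial 8 : ℝ) = 40320 := by norm_num [Nat.factorial]
  rw [h5] at h4
  calc |e s| * siteNorm s ^ 4
      ≤ C * ((a * siteNorm s) ^ 8 / 40320)⁻¹ * siteNorm s ^ 4 := by
        gcongr
        exact (h s).trans (by rw [h2]; gcongr)
    _ = _ := by
        rw [h3]
        field_simp

lemma IsDispersion.summable_mul_siteNorm {e : Site → ℝ} (he : IsDispersion e) :
    Summable fun s => |e s| * siteNorm s := by
  refine he.summable_mul_pow_four.of_nonneg_of_le
    (fun s => mul_nonneg (abs_nonneg _) (siteNorm_nonneg s)) fun s => ?_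
  refine mul_le_mul_of_nonneg_left ?_ (abs_nonneg _)
  rcases eq_or_ne s 0 with rfl | hs
  · simp [siteNorm_zero]
  · exact le_self_pow₀ (one_le_siteNorm hs) (by norm_num)

lemma summable_mul_cos {e : Site → ℝ} (he : Summable fun s => |e s|) (k : Momentum) :
    Summable fun s => e s * Real.cos (pairing k s) := by
  refine he.of_norm_bounded fun s => ?_
  rw [norm_mul, Real.norm_eq_abs, Real.norm_eq_abs]
  exact mul_le_of_le_one_right (abs_nonneg _) (Real.abs_cos_le_one _)

lemma dispersion_eq_tsum {e : Site → ℝ} (he : Summable fun s => |e s|) (k : Momentum) :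
    dispersion e k = ∑' s, e s * Real.cos (pairing k s) := by
  unfold dispersion fourierSeries
  rw [Complex.re_tsum]
  · refine tsum_congr fun s => ?_
    rw [Complex.re_ofReal_mul, mul_comm Complex.I, Complex.exp_ofReal_mul_I_re]
  · exact he.of_norm_bounded fun s => (norm_fourierSeries_term e s k).le

lemma continuous_dispersion {e : Site → ℝ} (he : Summable fun s => |e s|) :
    Continuous (dispersion e) :=
  Complex.continuous_re.comp (continuous_fourierSeries he)

lemma dispersion_neg {e : Site → ℝ} (he : Summable fun s => |e s|) (k : Momentum) :
    dispersion e (-k) = dispersion e k := by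
  simp [dispersion_eq_tsum he, pairing_neg]

/-- The cosine is 1-Lipschitz and the first moment is finite. The bound serves to compare the symbol
at `k` with the symbol at zero momentum. -/
lemma IsDispersion.exists_lipschitz {e : Site → ℝ} (he : IsDispersion e) :
    ∃ C : ℝ, 0 ≤ C ∧ ∀ k l, |dispersion e k - dispersion e l| ≤ C * ‖k - l‖ := by
  refine ⟨∑' s, |e s| * siteNorm s,
    tsum_nonneg fun s => mul_nonneg (abs_nonneg _) (siteNorm_nonneg s), fun k l => ?_⟩
  rw [dispersion_eq_tsum he.summable, dispersion_eq_tsum he.summable,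
    ← (summable_mul_cos he.summable k).tsum_sub (summable_mul_cos he.summable l),
    ← tsum_mul_right, ← Real.norm_eq_abs]
  refine tsum_of_norm_bounded (he.summable_mul_siteNorm.mul_right _).hasSum fun s => ?_
  rw [← mul_sub, norm_mul, Real.norm_eq_abs, Real.norm_eq_abs, mul_assoc]
  refine mul_le_mul_of_nonneg_left ?_ (abs_nonneg _)
  refine (Real.abs_cos_sub_cos_le _ _).trans ?_
  rw [← pairing_sub, mul_comm]
  exact abs_pairing_le _ _

/-- A quantitative local convexity of dispersion functions, in terms of second differences. -/
lemma IsDispersion.exists_secondDifference_bound {e : Site → ℝ} (he : IsDispersion e) :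
    ∃ c C : ℝ, 0 < c ∧ 0 ≤ C ∧ ∀ m d : Momentum, ‖d‖ ≤ Real.pi →
      (c - C * ‖m‖ ^ 2) * ‖d‖ ^ 2 ≤
        dispersion e (m + d) + dispersion e (m - d) - 2 * dispersion e m := by
  have hpi := Real.pi_pos
  set γ : ℝ := -e (Pi.single 0 1) with hγ
  have hγ0 : 0 < γ := by
    have := he.neg (Pi.single 0 1) (siteNorm_single 0)
    linarith
  refine ⟨2 * (γ * (2 / Real.pi ^ 2)), 2 * ((∑' s, |e s| * siteNorm s ^ 4) / 4), by positivity,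
    mul_nonneg zero_le_two (div_nonneg (tsum_nonneg fun s =>
      mul_nonneg (abs_nonneg _) (pow_nonneg (siteNorm_nonneg s) 4)) (by norm_num)), fun m d hd => ?_⟩
  have hs := he.summable
  obtain ⟨i, hi⟩ : ∃ i, ‖d‖ = |d i| := by
    obtain ⟨i, hi⟩ := Finite.exists_max fun j => ‖d j‖
    refine ⟨i, le_antisymm ?_ (norm_le_pi_norm d i)⟩
    exact (pi_norm_le_iff_of_nonneg (norm_nonneg _)).2 hi
  have hγi : -e (Pi.single i 1) = γ := by
    rw [hγ, he.radial _ _ ((siteNorm_single i).trans (siteNorm_single 0).symm)]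
  -- The addition formulas give `cos (x + y) + cos (x - y) - 2 cos x = -2 cos x (1 - cos y)`.
  have hS : HasSum (fun s => (-e s) * Real.cos (pairing m s) * (1 - Real.cos (pairing d s)))
      ((dispersion e (m + d) + dispersion e (m - d) - 2 * dispersion e m) / 2) := by
    simp only [dispersion_eq_tsum hs]
    have h := (((summable_mul_cos hs (m + d)).hasSum.add (summable_mul_cos hs (m - d)).hasSum).sub
      ((summable_mul_cos hs m).hasSum.mul_left 2)).mul_left 2⁻¹
    rw [div_eq_inv_mul]
    refine Eq.mpr (congrArg (HasSum · _) (funext fun s => ?_)) h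
    rw [pairing_add, pairing_sub, Real.cos_add, Real.cos_sub]
    ring
  -- Termwise minorant. Replacing `cos (m, s)` by 1 costs the quartic remainder. What is left is
  -- nonnegative, and only the unit vector along a coordinate with `|d i| = ‖d‖` is kept; there `1 -
  -- cos (d i)` is at least `2 / π² · ‖d‖²`.
  have hL : HasSum (fun s => (if s = Pi.single i 1 then γ * (1 - Real.cos (d i)) else 0) -
      |e s| * siteNorm s ^ 4 * (‖m‖ ^ 2 * ‖d‖ ^ 2 / 4))
      (γ * (1 - Real.cos (d i)) - (∑' s, |e s| * siteNorm s ^ 4) * (‖m‖ ^ 2 * ‖d‖ ^ 2 / 4)) :=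
    (hasSum_ite_eq _ _).sub (he.summable_mul_pow_four.hasSum.mul_right _)
  have hle := hasSum_le (fun s => ?_) hL hS
  · have h1 : 2 / Real.pi ^ 2 * ‖d‖ ^ 2 ≤ 1 - Real.cos (d i) := by
      have := Real.cos_le_one_sub_mul_cos_sq (x := d i) (hi ▸ hd)
      rw [hi, sq_abs]
      linarith
    have h2 := mul_le_mul_of_nonneg_left h1 hγ0.le
    linarith
  · have hN := siteNorm_nonneg s
    -- The sign of `e 0` is not prescribed, but its term vanishes because `1 - cos 0 = 0`.
    rcases eq_or_ne s 0 with rfl | h0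
    · have : (0 : Site) ≠ Pi.single i 1 := fun h => by simpa using congrFun h i
      simp [this, pairing, siteNorm_zero]
    have he0 : 0 ≤ -e s := by linarith [he.nonpos_of_ne_zero h0]
    have habs : |e s| = -e s := abs_of_nonpos (by linarith)
    have hcm : 1 - (‖m‖ * siteNorm s) ^ 2 / 2 ≤ Real.cos (pairing m s) := by
      have h1 := Real.one_sub_sq_div_two_le_cos (x := pairing m s)
      have h2 : (pairing m s) ^ 2 ≤ (‖m‖ * siteNorm s) ^ 2 :=
        sq_le_sq' (abs_le.1 (abs_pairing_le m s)).1 (abs_le.1 (abs_pairing_le m s)).2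
      linarith
    have hcd : 1 - Real.cos (pairing d s) ≤ (‖d‖ * siteNorm s) ^ 2 / 2 := by
      have h1 := Real.one_sub_sq_div_two_le_cos (x := pairing d s)
      have h2 : (pairing d s) ^ 2 ≤ (‖d‖ * siteNorm s) ^ 2 :=
        sq_le_sq' (abs_le.1 (abs_pairing_le d s)).1 (abs_le.1 (abs_pairing_le d s)).2
      linarith
    have hcd0 : 0 ≤ 1 - Real.cos (pairing d s) := by linarith [Real.cos_le_one (pairing d s)]
    have key : (-e s) * (1 - Real.cos (pairing d s)) -
        |e s| * siteNorm s ^ 4 * (‖m‖ ^ 2 * ‖d‖ ^ 2 / 4) ≤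
        (-e s) * Real.cos (pairing m s) * (1 - Real.cos (pairing d s)) := by
      rw [habs]
      have h1 := mul_le_mul_of_nonneg_left (mul_le_mul_of_nonneg_right hcm hcd0) he0
      have h2 : (‖m‖ * siteNorm s) ^ 2 / 2 * (1 - Real.cos (pairing d s)) ≤
          (‖m‖ * siteNorm s) ^ 2 / 2 * ((‖d‖ * siteNorm s) ^ 2 / 2) :=
        mul_le_mul_of_nonneg_left hcd (by positivity)
      have h3 := mul_le_mul_of_nonneg_left h2 he0
      nlinarith
    refine le_trans (sub_le_sub_right ?_ _) key
    split_ifs with h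
    · rw [h, pairing_single, hγi]
    · exact mul_nonneg he0 hcd0

/-! ### The two-particle symbol near zero total momentum -/

/-- This places both mass ratios in `[0, 1]`, so that rescaling `k` by them does not increase its
norm. Strict positivity is not needed, since a zero denominator makes the ratio zero. -/
lemma IsDispersion.mass_nonneg {e : Site → ℝ} (he : IsDispersion e) : 0 ≤ mass e := by
  unfold mass
  refine mul_nonneg (by norm_num) (inv_nonneg.2 ?_)
  rw [← tsum_neg]
  refine tsum_nonneg fun s => ?_
  rcases eq_or_ne s 0 with rfl | hs
  · simp
  · rw [← mul_neg]
    exact mul_nonneg (by positivity) (by linarith [he.nonpos_of_ne_zero hs])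

lemma mem_torus_of_norm_lt {q : Momentum} (hq : ‖q‖ < Real.pi) : q ∈ torus := fun i _ => by
  have h := (norm_le_pi_norm q i).trans_lt hq
  rw [Real.norm_eq_abs, abs_lt] at h
  exact ⟨h.1, h.2.le⟩

lemma norm_le_of_mem_torus {q : Momentum} (hq : q ∈ torus) : ‖q‖ ≤ Real.pi :=
  (pi_norm_le_iff_of_nonneg Real.pi_pos.le).2 fun i =>
    abs_le.2 ⟨(hq i trivial).1.le, (hq i trivial).2⟩

lemma continuous_pairEnergy {e : Fin 3 → Site → ℝ} (he : ∀ α, IsDispersion (e α)) (α : Fin 3)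
    (k : Momentum) : Continuous (pairEnergy e α k) := by
  have h1 := continuous_dispersion (he (α + 1)).summable
  have h2 := continuous_dispersion (he (α + 2)).summable
  unfold pairEnergy
  fun_prop

/-- Near zero total momentum, the symbol has a nondegenerate minimum. -/
lemma exists_quadratic_lower_bound {e : Fin 3 → Site → ℝ} (he : ∀ α, IsDispersion (e α))
    (α : Fin 3) : ∃ δ : ℝ, 0 < δ ∧ ∀ k : Momentum, ‖k‖ < δ →
      ∃ a : Momentum, ∃ c : ℝ, 0 < c ∧ ∀ q ∈ torus,
        thresholdEnergy e α k + c * ‖q - a‖ ^ 2 ≤ pairEnergy e α k q := by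
  obtain ⟨c₁, C₁, hc₁, hC₁, h₁⟩ := (he (α + 1)).exists_secondDifference_bound
  obtain ⟨c₂, C₂, hc₂, hC₂, h₂⟩ := (he (α + 2)).exists_secondDifference_bound
  obtain ⟨L₁, hL₁, hl₁⟩ := (he (α + 1)).exists_lipschitz
  obtain ⟨L₂, hL₂, hl₂⟩ := (he (α + 2)).exists_lipschitz
  set ε₁ := dispersion (e (α + 1))
  set ε₂ := dispersion (e (α + 2))
  set l₁ := mass (e (α + 1)) / (mass (e (α + 1)) + mass (e (α + 2)))
  set l₂ := mass (e (α + 2)) / (mass (e (α + 1)) + mass (e (α + 2)))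
  have hm₁ := (he (α + 1)).mass_nonneg
  have hm₂ := (he (α + 2)).mass_nonneg
  have hl₁' : |l₁| ≤ 1 := by
    rw [abs_of_nonneg (by positivity)]
    exact div_le_one_of_le₀ (by linarith) (by positivity)
  have hl₂' : |l₂| ≤ 1 := by
    rw [abs_of_nonneg (by positivity)]
    exact div_le_one_of_le₀ (by linarith) (by positivity)
  have hE : ∀ k q, pairEnergy e α k q = ε₁ (l₁ • k + q) + ε₂ (l₂ • k - q) := fun _ _ => rfl
  have hk₁ : ∀ k : Momentum, ‖l₁ • k‖ ≤ ‖k‖ := fun k => by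
    rw [norm_smul]; exact mul_le_of_le_one_left (norm_nonneg _) hl₁'
  have hk₂ : ∀ k : Momentum, ‖l₂ • k‖ ≤ ‖k‖ := fun k => by
    rw [norm_smul]; exact mul_le_of_le_one_left (norm_nonneg _) hl₂'
  have hpi := Real.pi_pos
  -- The size of the box in which the symbol is uniformly convex.
  obtain ⟨ρ, hρ, hρpi, hρc⟩ : ∃ ρ : ℝ, 0 < ρ ∧ ρ < Real.pi ∧
      (C₁ + C₂) * (2 * ρ) ^ 2 < (c₁ + c₂) / 2 := by
    have h : ∀ᶠ ρ : ℝ in 𝓝 0, (C₁ + C₂) * (2 * ρ) ^ 2 < (c₁ + c₂) / 2 := by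
      refine (Continuous.tendsto' (by fun_prop) 0 0 (by simp)).eventually (gt_mem_nhds ?_)
      positivity
    have h' := ((h.filter_mono nhdsWithin_le_nhds).and
      (Ioo_mem_nhdsGT hpi)).exists
    obtain ⟨ρ, h1, h2⟩ := h'
    exact ⟨ρ, h2.1, h2.2, h1⟩
  set c₀ := (c₁ + c₂) / 2 * ρ ^ 2 with hc₀
  have hc₀0 : 0 < c₀ := by positivity
  -- Symbol at zero momentum, away from the origin.
  have hzero : ∀ q : Momentum, ρ ≤ ‖q‖ → ‖q‖ ≤ Real.pi →
      pairEnergy e α 0 0 + c₀ ≤ pairEnergy e α 0 q := fun q hq hq' => by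
    -- By evenness, the second difference at the origin is twice the increment from `0` to `q`.
    have a1 := h₁ 0 q hq'
    have a2 := h₂ 0 q hq'
    have n1 : ε₁ (-q) = ε₁ q := dispersion_neg (he (α + 1)).summable q
    have n2 : ε₂ (-q) = ε₂ q := dispersion_neg (he (α + 2)).summable q
    simp only [norm_zero, zero_add, zero_sub, n1, n2] at a1 a2
    simp only [hE, smul_zero, zero_add, zero_sub, n2, sub_zero]
    have : ρ ^ 2 ≤ ‖q‖ ^ 2 := by gcongr
    nlinarith
  have hlip : ∀ k q, |pairEnergy e α k q - pairEnergy e α 0 q| ≤ (L₁ + L₂) * ‖k‖ := fun k q => by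
    have b1 := hl₁ (l₁ • k + q) q
    have b2 := hl₂ (l₂ • k - q) (-q)
    rw [add_sub_cancel_right] at b1
    rw [sub_neg_eq_add, sub_add_cancel] at b2
    simp only [hE, smul_zero, zero_add, zero_sub]
    have b3 := mul_le_mul_of_nonneg_left (hk₁ k) hL₁
    have b4 := mul_le_mul_of_nonneg_left (hk₂ k) hL₂
    rw [abs_le] at b1 b2 ⊢
    constructor <;> linarith [b1.1, b1.2, b2.1, b2.2]
  -- The first bound keeps the arguments `l₁ • k + m` and `l₂ • k - m` within `2 * ρ`. The second
  -- makes each Lipschitz error at most `c₀ / 4`, so two of them leave half of the gap `c₀`.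
  refine ⟨min ρ (c₀ / (4 * (L₁ + L₂ + 1))), lt_min hρ (by positivity), fun k hk => ?_⟩
  have hkρ : ‖k‖ < ρ := hk.trans_le (min_le_left _ _)
  have hkL : (L₁ + L₂) * ‖k‖ ≤ c₀ / 4 := by
    have := hk.le.trans (min_le_right _ _)
    rw [le_div_iff₀ (by positivity)] at this
    nlinarith [norm_nonneg k]
  have haway : ∀ q : Momentum, ρ ≤ ‖q‖ → ‖q‖ ≤ Real.pi →
      pairEnergy e α k 0 + c₀ / 2 ≤ pairEnergy e α k q := fun q hq hq' => by
    have := hzero q hq hq'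
    have b1 := abs_le.1 (hlip k q)
    have b2 := abs_le.1 (hlip k 0)
    linarith [b1.1, b2.2]
  -- A minimizer over the box `‖q‖ ≤ ρ`; the gap outside the box makes it a minimizer over the whole
  -- torus.
  obtain ⟨a, ha, hmin⟩ := (isCompact_closedBall (0 : Momentum) ρ).exists_isMinOn
    ⟨0, by simpa using hρ.le⟩ (continuous_pairEnergy he α k).continuousOn
  have haρ : ‖a‖ ≤ ρ := by simpa using ha
  have hmin0 : pairEnergy e α k a ≤ pairEnergy e α k 0 := hmin (by simpa using hρ.le)
  have hball : ∀ q : Momentum, ‖q‖ ≤ ρ → pairEnergy e α k a ≤ pairEnergy e α k q := fun q hq =>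
    hmin (by simpa using hq)
  have hmint : ∀ q ∈ torus, pairEnergy e α k a ≤ pairEnergy e α k q := fun q hq => by
    rcases le_total ‖q‖ ρ with h | h
    · exact hball q h
    · linarith [haway q h (norm_le_of_mem_torus hq)]
  have hthr : thresholdEnergy e α k ≤ pairEnergy e α k a :=
    csInf_le ⟨_, by rintro _ ⟨q, hq, rfl⟩; exact hmint q hq⟩
      ⟨a, mem_torus_of_norm_lt (haρ.trans_lt hρpi), rfl⟩
  -- The first constant comes from the midpoint argument inside the box. The second spreads the gap
  -- `c₀ / 2` over `‖q - a‖ ≤ 2π` outside it.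
  refine ⟨a, min ((c₁ + c₂) / 8) (c₀ / 2 / (2 * Real.pi) ^ 2), lt_min (by positivity)
    (by positivity), fun q hq => ?_⟩
  have hqpi := norm_le_of_mem_torus hq
  rcases le_total ‖q‖ ρ with h | h
  -- Second difference at the midpoint `m` of `a` and `q`: since `E m ≥ E a`, the quantity `E q + E
  -- a - 2 E m` is at most `E q - E a`. No derivative at `a` is involved. As `‖d‖ = ‖q - a‖ / 2`,
  -- the constant `(c₁ + c₂) / 2` becomes `(c₁ + c₂) / 8`.
  · set d : Momentum := (2⁻¹ : ℝ) • (q - a) with hd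
    set m : Momentum := (2⁻¹ : ℝ) • (q + a) with hm
    have hmd : m + d = q := by rw [hd, hm]; module
    have hmd' : m - d = a := by rw [hd, hm]; module
    have hdn : ‖d‖ = ‖q - a‖ / 2 := by
      rw [hd, norm_smul, Real.norm_of_nonneg (by norm_num)]; ring
    have hmn : ‖m‖ ≤ ρ := by
      rw [hm, norm_smul, Real.norm_of_nonneg (by norm_num)]
      linarith [norm_add_le q a]
    have hdpi : ‖d‖ ≤ Real.pi := by
      rw [hdn]
      linarith [norm_sub_le q a]
    have a1 := h₁ (l₁ • k + m) d hdpi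
    have a2 := h₂ (l₂ • k - m) d hdpi
    have e1 : l₁ • k + m + d = l₁ • k + q := by rw [add_assoc, hmd]
    have e2 : l₁ • k + m - d = l₁ • k + a := by rw [add_sub_assoc, hmd']
    have e3 : l₂ • k - m + d = l₂ • k - a := by rw [← hmd']; abel
    have e4 : l₂ • k - m - d = l₂ • k - q := by rw [← hmd]; abel
    rw [e1, e2] at a1
    rw [e3, e4] at a2
    have hmE := hball m hmn
    have hy1 : ‖l₁ • k + m‖ ^ 2 ≤ (2 * ρ) ^ 2 := by
      gcongr
      linarith [norm_add_le (l₁ • k) m, hk₁ k]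
    have hy2 : ‖l₂ • k - m‖ ^ 2 ≤ (2 * ρ) ^ 2 := by
      gcongr
      linarith [norm_sub_le (l₂ • k) m, hk₂ k]
    have hc : (c₁ + c₂) / 2 * ‖d‖ ^ 2 ≤ (c₁ - C₁ * ‖l₁ • k + m‖ ^ 2) * ‖d‖ ^ 2 +
        (c₂ - C₂ * ‖l₂ • k - m‖ ^ 2) * ‖d‖ ^ 2 := by
      rw [← add_mul]
      refine mul_le_mul_of_nonneg_right ?_ (sq_nonneg _)
      have := mul_le_mul_of_nonneg_left hy1 hC₁
      have := mul_le_mul_of_nonneg_left hy2 hC₂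
      linarith
    have hfin : (c₁ + c₂) / 8 * ‖q - a‖ ^ 2 ≤ pairEnergy e α k q - pairEnergy e α k a := by
      rw [hdn] at hc a1 a2
      simp only [hE] at hmE ⊢
      linarith
    have := mul_le_mul_of_nonneg_right
      (min_le_left ((c₁ + c₂) / 8) (c₀ / 2 / (2 * Real.pi) ^ 2)) (sq_nonneg ‖q - a‖)
    linarith
  · have h1 := haway q h hqpi
    have h2 : ‖q - a‖ ^ 2 ≤ (2 * Real.pi) ^ 2 := by
      gcongr
      linarith [norm_sub_le q a]
    have h3 := mul_le_mul (min_le_right ((c₁ + c₂) / 8) (c₀ / 2 / (2 * Real.pi) ^ 2)) h2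
      (sq_nonneg _) (by positivity)
    rw [div_mul_cancel₀ _ (by positivity)] at h3
    linarith

/-- In dimension three, `‖q - a‖⁻²` is integrable over bounded sets. -/
lemma integrable_inv_sq_norm_sub (a : Momentum) :
    Integrable (fun q => (‖q - a‖ ^ 2)⁻¹) torusMeasure := by
  -- The torus lies in the ball of radius `R` about `a`, so cutting off at `R` loses nothing. In
  -- polar coordinates the Jacobian `r²` cancels the singularity exactly.
  set R : ℝ := Real.pi + ‖a‖ with hR
  have h0 : Integrable (fun x : Momentum => (Set.Iic R).indicator (fun r : ℝ => (r ^ 2)⁻¹) ‖x‖)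
      volume := by
    rw [integrable_fun_norm_addHaar]
    have hfin : Module.finrank ℝ Momentum - 1 = 2 := by simp
    rw [hfin]
    have h1 : IntegrableOn (fun _ : ℝ => (1 : ℝ)) (Set.Ioc 0 R) volume :=
      integrableOn_const (by simp)
    have h2 : IntegrableOn ((Set.Iic R).indicator fun _ : ℝ => (1 : ℝ)) (Set.Ioi 0) volume := by
      rw [integrableOn_indicator_iff measurableSet_Iic, Set.inter_comm, Set.Ioi_inter_Iic]
      exact h1
    refine h2.congr_fun (fun r hr => ?_) measurableSet_Ioi
    have hr0 : (r : ℝ) ^ 2 ≠ 0 := pow_ne_zero _ (ne_of_gt hr)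
    by_cases hrR : r ∈ Set.Iic R
    · simp [Set.indicator_of_mem hrR, hr0]
    · simp [Set.indicator_of_notMem hrR]
  have h1 := (h0.comp_sub_right a).restrict (s := torus)
  refine h1.congr ?_
  have hmeas : MeasurableSet torus := MeasurableSet.univ_pi fun _ => measurableSet_Ioc
  filter_upwards [ae_restrict_mem hmeas] with q hq
  rw [Set.indicator_of_mem]
  exact (norm_sub_le q a).trans (by linarith [norm_le_of_mem_torus hq])

lemma hasSum_of_eq {ι α : Type*} [AddCommMonoid α] [TopologicalSpace α] {f g : ι → α} {a b : α}
    (h : HasSum f a) (hfg : ∀ i, g i = f i) (hab : b = a) : HasSum g b := by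
  rwa [funext hfg, hab]

/-! ### Operators with square integrable kernels -/

lemma enorm_sq_Lp_two {X : Type*} [MeasurableSpace X] {μ : Measure X} (f : Lp ℂ 2 μ) :
    ‖f‖ₑ ^ 2 = ∫⁻ x, ‖f x‖ₑ ^ 2 ∂μ := by
  rw [Lp.enorm_def]
  simpa using eLpNorm_nnreal_pow_eq_lintegral (μ := μ) (f := f) (p := 2) two_ne_zero

/-- Bessel's inequality for an operator with a square integrable kernel. -/
lemma HasKernel.tsum_enorm_sq_le {K : Momentum → Momentum → ℂ} {T : L2Torus →L[ℂ] L2Torus}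
    (hT : HasKernel T K) (hK : MemLp (Function.uncurry K) 2 (torusMeasure.prod torusMeasure))
    {ι : Type*} {b : ι → L2Torus} (hb : Orthonormal ℂ b) :
    ∑' i, ‖T (b i)‖ₑ ^ 2 ≤ eLpNorm (Function.uncurry K) 2 (torusMeasure.prod torusMeasure) ^ 2 := by
  have hsq : ∀ {g : Momentum → ℂ}, eLpNorm g 2 torusMeasure ^ 2 = ∫⁻ q, ‖g q‖ₑ ^ 2 ∂torusMeasure :=
    fun {g} => by
      simpa using eLpNorm_nnreal_pow_eq_lintegral (μ := torusMeasure) (f := g) (p := 2) two_ne_zero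
  have hKm := hK.aestronglyMeasurable
  have hKsq : ∫⁻ p, eLpNorm (K p) 2 torusMeasure ^ 2 ∂torusMeasure =
      eLpNorm (Function.uncurry K) 2 (torusMeasure.prod torusMeasure) ^ 2 := by
    have h := eLpNorm_nnreal_pow_eq_lintegral (μ := torusMeasure.prod torusMeasure)
      (f := Function.uncurry K) (p := 2) two_ne_zero
    have h' : eLpNorm (Function.uncurry K) 2 (torusMeasure.prod torusMeasure) ^ 2 =
        ∫⁻ x, ‖Function.uncurry K x‖ₑ ^ 2 ∂(torusMeasure.prod torusMeasure) := by simpa using h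
    rw [h', lintegral_prod _ (hKm.enorm.pow_const 2)]
    exact lintegral_congr fun p => hsq
  have hKmeas : AEMeasurable (fun p => eLpNorm (K p) 2 torusMeasure ^ 2) torusMeasure := by
    simp_rw [hsq]
    exact (hKm.enorm.pow_const 2).lintegral_prod_right'
  have hKfin : ∀ᵐ p ∂torusMeasure, MemLp (K p) 2 torusMeasure := by
    have h : ∀ᵐ p ∂torusMeasure, eLpNorm (K p) 2 torusMeasure ^ 2 < ∞ := by
      refine ae_lt_top' hKmeas ?_
      rw [hKsq]
      exact ENNReal.pow_ne_top hK.eLpNorm_ne_top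
    filter_upwards [h, hKm.prodMk_left] with p h1 h2
    exact ⟨h2, by simpa using h1⟩
  refine ENNReal.summable.tsum_le_of_sum_le fun s => ?_
  simp_rw [enorm_sq_Lp_two]
  rw [← lintegral_finsetSum' _ fun i _ => (Lp.aestronglyMeasurable (T (b i))).enorm.pow_const 2,
    ← hKsq]
  refine lintegral_mono_ae ?_
  have hall : ∀ᵐ p ∂torusMeasure, ∀ i ∈ s, T (b i) p = ∫ q, K p q * b i q ∂torusMeasure := by
    refine (ae_ball_iff s.countable_toSet).2
      fun i _ => (hT (b i)).mono fun p hp => hp.2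
  filter_upwards [hKfin, hall] with p hp hTp
  -- For fixed `p`, the values `T (b i) p` are the coefficients of the conjugate of `K p` in the
  -- family `b`, up to conjugation. Bessel's inequality is applied for each `p` and then integrated.
  set x : L2Torus := hp.star.toLp with hx
  have hxn : ‖x‖ₑ = eLpNorm (K p) 2 torusMeasure := by
    rw [Lp.enorm_toLp]
    exact eLpNorm_congr_norm_ae (ae_of_all _ fun q => by simp)
  have hin : ∀ i ∈ s, ‖T (b i) p‖ = ‖inner ℂ (b i) x‖ := fun i hi => by
    rw [hTp i hi, ← norm_inner_symm, L2.inner_def]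
    congr 1
    refine integral_congr_ae ?_
    filter_upwards [hp.star.coeFn_toLp] with q hq
    rw [RCLike.inner_apply, hx, hq]
    simp [mul_comm]
  rw [← hxn]
  have hB := hb.sum_inner_products_le x (s := s)
  have hB' := ENNReal.ofReal_le_ofReal hB
  rw [ENNReal.ofReal_sum_of_nonneg fun _ _ => sq_nonneg _] at hB'
  refine le_trans (le_of_eq ?_) (hB'.trans_eq ?_)
  · refine Finset.sum_congr rfl fun i hi => ?_
    rw [← hin i hi, ENNReal.ofReal_pow (norm_nonneg _), ofReal_norm]
  · rw [ENNReal.ofReal_pow (norm_nonneg _), ofReal_norm]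

lemma HasKernel.isHilbertSchmidt {K : Momentum → Momentum → ℂ} {T : L2Torus →L[ℂ] L2Torus}
    (hT : HasKernel T K) (hK : MemLp (Function.uncurry K) 2 (torusMeasure.prod torusMeasure)) :
    IsHilbertSchmidt T := fun _ b =>
  (hT.tsum_enorm_sq_le hK b.orthonormal).trans_lt
    (ENNReal.pow_lt_top hK.eLpNorm_lt_top)

/-- A single unit vector is an orthonormal family, so the Bessel bound also controls the operator
norm. -/
lemma HasKernel.enorm_le {K : Momentum → Momentum → ℂ} {T : L2Torus →L[ℂ] L2Torus}
    (hT : HasKernel T K) (hK : MemLp (Function.uncurry K) 2 (torusMeasure.prod torusMeasure)) :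
    ‖T‖ₑ ≤ eLpNorm (Function.uncurry K) 2 (torusMeasure.prod torusMeasure) := by
  have hfin := hK.eLpNorm_ne_top
  rw [← ENNReal.ofReal_toReal hfin, ← ofReal_norm]
  refine ENNReal.ofReal_le_ofReal (ContinuousLinearMap.opNorm_le_of_unit_norm ENNReal.toReal_nonneg fun f hf => ?_)
  have horth : Orthonormal ℂ fun _ : Unit => f :=
    ⟨fun _ => hf, fun i j hij => absurd (Subsingleton.elim i j) hij⟩
  have h := hT.tsum_enorm_sq_le hK horth
  rw [tsum_fintype, Finset.univ_unique, Finset.sum_singleton,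
    ENNReal.pow_le_pow_left_iff two_ne_zero] at h
  rw [← toReal_enorm]
  exact ENNReal.toReal_mono hfin h

lemma HasKernel.sub {K K' : Momentum → Momentum → ℂ} {T T' : L2Torus →L[ℂ] L2Torus}
    (hT : HasKernel T K) (hT' : HasKernel T' K') :
    HasKernel (T - T') fun p q => K p q - K' p q := fun f => by
  filter_upwards [hT f, hT' f, Lp.coeFn_sub (T f) (T' f)] with p h1 h2 h3
  simp only [sub_mul]
  refine ⟨h1.1.sub h2.1, ?_⟩
  rw [integral_sub h1.1 h2.1, ← h1.2, ← h2.2, sub_apply, h3, Pi.sub_apply]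

/-! ### Weighted interaction operators -/

/-- The kernel of `w v w`, where `v` is the interaction operator and `w` is a weight. -/
def weightedKernel (v : Site → ℝ) (w : Momentum → ℝ) (p q : Momentum) : ℂ :=
  interactionKernel v p q * ((w p * w q : ℝ) : ℂ)

/-- The square of the normalizing factor `(2π)^{-3/2}`. -/
def couplingConst : ℝ := ((2 * Real.pi) ^ (-(3 / 2) : ℝ)) ^ 2

lemma couplingConst_nonneg : 0 ≤ couplingConst := sq_nonneg _

lemma interactionKernel_eq (v : Site → ℝ) (p q : Momentum) :
    interactionKernel v p q = (couplingConst : ℂ) * fourierSeries v (p - q) := by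
  unfold interactionKernel potential couplingConst
  push_cast
  ring

lemma norm_interactionKernel_le {v : Site → ℝ} (hv : Summable fun s => |v s|) (p q : Momentum) :
    ‖interactionKernel v p q‖ ≤ couplingConst * ∑' s, |v s| := by
  rw [interactionKernel_eq, norm_mul, Complex.norm_real, Real.norm_of_nonneg couplingConst_nonneg]
  exact mul_le_mul_of_nonneg_left (norm_fourierSeries_le hv _) couplingConst_nonneg

lemma continuous_interactionKernel {v : Site → ℝ} (hv : Summable fun s => |v s|) :
    Continuous fun x : Momentum × Momentum => interactionKernel v x.1 x.2 := by
  have := continuous_fourierSeries hv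
  simp only [interactionKernel_eq]
  fun_prop

lemma memLp_tensor {X : Type*} [MeasurableSpace X] {μ : Measure X} [SFinite μ] {f g : X → ℝ}
    (hf : MemLp f 2 μ) (hg : MemLp g 2 μ) :
    MemLp (fun x : X × X => f x.1 * g x.2) 2 (μ.prod μ) := by
  rw [memLp_two_iff_integrable_sq]
  · simp only [mul_pow]
    exact hf.integrable_sq.mul_prod hg.integrable_sq
  · exact hf.1.comp_fst.mul hg.1.comp_snd

lemma memLp_interactionKernel_mul {v : Site → ℝ} (hv : Summable fun s => |v s|)
    {F : Momentum × Momentum → ℝ} (hF : MemLp F 2 (torusMeasure.prod torusMeasure)) :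
    MemLp (fun x : Momentum × Momentum => interactionKernel v x.1 x.2 * (F x : ℂ)) 2
      (torusMeasure.prod torusMeasure) := by
  refine MemLp.of_le_mul (c := couplingConst * ∑' s, |v s|) hF
    ((continuous_interactionKernel hv).aestronglyMeasurable.mul
      (Complex.continuous_ofReal.comp_aestronglyMeasurable hF.1)) (ae_of_all _ fun x => ?_)
  rw [norm_mul, Complex.norm_real]
  exact mul_le_mul_of_nonneg_right (norm_interactionKernel_le hv _ _) (norm_nonneg _)

lemma memLp_weightedKernel {v : Site → ℝ} (hv : Summable fun s => |v s|) {w : Momentum → ℝ}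
    (hw : MemLp w 2 torusMeasure) :
    MemLp (Function.uncurry (weightedKernel v w)) 2 (torusMeasure.prod torusMeasure) :=
  memLp_interactionKernel_mul hv (memLp_tensor hw hw)

/-! ### Plane-wave expansion, positivity and compactness -/

/-- The character `e^{i(p,s)}`. -/
def phase (p : Momentum) (s : Site) : ℂ := Complex.exp (Complex.I * (pairing p s : ℂ))

lemma norm_phase (p : Momentum) (s : Site) : ‖phase p s‖ = 1 := by
  rw [phase, mul_comm Complex.I, Complex.norm_exp_ofReal_mul_I]

lemma continuous_phase (s : Site) : Continuous fun p => phase p s := by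
  unfold phase pairing
  fun_prop

lemma phase_sub (p q : Momentum) (s : Site) :
    phase (p - q) s = phase p s * (starRingEnd ℂ) (phase q s) := by
  simp only [phase, ← Complex.exp_conj, ← Complex.exp_add, pairing_sub]
  congr 1
  simp
  ring

lemma memLp_phase_mul {w : Momentum → ℝ} (hw : MemLp w 2 torusMeasure) (s : Site) :
    MemLp (fun p => phase p s * (w p : ℂ)) 2 torusMeasure := by
  refine hw.of_le ((continuous_phase s).aestronglyMeasurable.mul
    (Complex.continuous_ofReal.comp_aestronglyMeasurable hw.1)) (ae_of_all _ fun p => ?_)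
  rw [norm_mul, norm_phase, one_mul, Complex.norm_real]

/-- The function `e^{i(p,s)} w(p)` as an element of `L₂(𝕋³)`. -/
def phaseVector {w : Momentum → ℝ} (hw : MemLp w 2 torusMeasure) (s : Site) : L2Torus :=
  (memLp_phase_mul hw s).toLp

lemma norm_phaseVector {w : Momentum → ℝ} (hw : MemLp w 2 torusMeasure) (s : Site) :
    ‖phaseVector hw s‖ = (eLpNorm w 2 torusMeasure).toReal := by
  rw [phaseVector, Lp.norm_toLp]
  congr 1
  refine eLpNorm_congr_norm_ae (ae_of_all _ fun p => ?_)
  rw [norm_mul, norm_phase, one_mul, Complex.norm_real]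

lemma inner_phaseVector {w : Momentum → ℝ} (hw : MemLp w 2 torusMeasure) (s : Site)
    (f : L2Torus) :
    inner ℂ (phaseVector hw s) f =
      ∫ q, (starRingEnd ℂ) (phase q s) * (w q : ℂ) * f q ∂torusMeasure := by
  rw [L2.inner_def]
  refine integral_congr_ae ?_
  filter_upwards [(memLp_phase_mul hw s).coeFn_toLp] with q hq
  rw [phaseVector, hq, RCLike.inner_apply]
  simp
  ring

lemma norm_inner_phaseVector_le {w : Momentum → ℝ} (hw : MemLp w 2 torusMeasure) (s : Site)
    (f : L2Torus) :
    ‖inner ℂ (phaseVector hw s) f‖ ≤ (eLpNorm w 2 torusMeasure).toReal * ‖f‖ := by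
  rw [← norm_phaseVector hw s]
  exact norm_inner_le_norm _ _

lemma integrable_phase_mul {w : Momentum → ℝ} (hw : MemLp w 2 torusMeasure) (s : Site)
    (f : L2Torus) : Integrable (fun q => phase q s * (w q : ℂ) * f q) torusMeasure :=
  (memLp_phase_mul hw s).integrable_mul (Lp.memLp f)

/-- The expansion of a weighted interaction operator in plane waves, pointwise. -/
lemma HasKernel.hasSum_apply {v : Site → ℝ} (hv : Summable fun s => |v s|) {w : Momentum → ℝ}
    (hw : MemLp w 2 torusMeasure) {T : L2Torus →L[ℂ] L2Torus}
    (hT : HasKernel T (weightedKernel v w)) (f : L2Torus) :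
    ∀ᵐ p ∂torusMeasure, HasSum (fun s => ((couplingConst * v s : ℝ) : ℂ) *
      inner ℂ (phaseVector hw s) f * (phase p s * (w p : ℂ))) (T f p) := by
  filter_upwards [hT f] with p hp
  rw [hp.2]
  have hI : ∀ s, Integrable (fun q => ((couplingConst * v s : ℝ) : ℂ) * (phase p s * (w p : ℂ)) *
      ((starRingEnd ℂ) (phase q s) * (w q : ℂ) * f q)) torusMeasure := fun s => by
    refine Integrable.const_mul ?_ _
    refine (integrable_phase_mul hw s f).norm.mono'
      (((Complex.continuous_conj.comp (continuous_phase s)).aestronglyMeasurable.mul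
        (Complex.continuous_ofReal.comp_aestronglyMeasurable hw.1)).mul
        (Lp.aestronglyMeasurable f)) (ae_of_all _ fun q => ?_)
    simp
  -- The dependence on `s` is only through `|v s|`, because phases have modulus one. This permits
  -- exchanging the sum and the integral.
  have hn : ∀ s, ∫ q, ‖((couplingConst * v s : ℝ) : ℂ) * (phase p s * (w p : ℂ)) *
      ((starRingEnd ℂ) (phase q s) * (w q : ℂ) * f q)‖ ∂torusMeasure =
      |v s| * (couplingConst * |w p| * ∫ q, |w q| * ‖f q‖ ∂torusMeasure) := fun s => by
    rw [← integral_const_mul, ← integral_const_mul]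
    refine integral_congr_ae (ae_of_all _ fun q => ?_)
    simp only [norm_mul, RCLike.norm_conj, norm_phase, Complex.norm_real, Real.norm_eq_abs,
      abs_of_nonneg couplingConst_nonneg]
    ring
  have h := hasSum_integral_of_summable_integral_norm hI
    (by simp only [hn]; exact hv.mul_right _)
  refine hasSum_of_eq h (fun s => ?_) ?_
  · rw [integral_const_mul, inner_phaseVector]
    ring
  · refine integral_congr_ae (ae_of_all _ fun q => ?_)
    simp only [weightedKernel, interactionKernel_eq, fourierSeries]
    rw [← tsum_mul_left, ← tsum_mul_right, ← tsum_mul_right]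
    refine tsum_congr fun s => ?_
    change (couplingConst : ℂ) * ((v s : ℂ) * phase (p - q) s) * _ * _ = _
    rw [phase_sub]
    push_cast
    ring

/-- The sesquilinear form of a weighted interaction operator. -/
lemma HasKernel.hasSum_inner {v : Site → ℝ} (hv : Summable fun s => |v s|) {w : Momentum → ℝ}
    (hw : MemLp w 2 torusMeasure) {T : L2Torus →L[ℂ] L2Torus}
    (hT : HasKernel T (weightedKernel v w)) (f g : L2Torus) :
    HasSum (fun s => ((couplingConst * v s : ℝ) : ℂ) *
      (inner ℂ (phaseVector hw s) f * inner ℂ g (phaseVector hw s))) (inner ℂ g (T f)) := by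
  have hin : ∀ s, inner ℂ g (phaseVector hw s) =
      ∫ p, phase p s * (w p : ℂ) * (starRingEnd ℂ) (g p) ∂torusMeasure := fun s => by
    rw [L2.inner_def]
    refine integral_congr_ae ?_
    filter_upwards [(memLp_phase_mul hw s).coeFn_toLp] with q hq
    rw [phaseVector, hq, RCLike.inner_apply]
  have hI : ∀ s, Integrable (fun p => ((couplingConst * v s : ℝ) : ℂ) *
      inner ℂ (phaseVector hw s) f * (phase p s * (w p : ℂ) * (starRingEnd ℂ) (g p)))
      torusMeasure := fun s =>
    ((memLp_phase_mul hw s).integrable_mul (Lp.memLp g).star).const_mul _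
  set A := (eLpNorm w 2 torusMeasure).toReal
  have hn : ∀ s, ∫ p, ‖((couplingConst * v s : ℝ) : ℂ) * inner ℂ (phaseVector hw s) f *
      (phase p s * (w p : ℂ) * (starRingEnd ℂ) (g p))‖ ∂torusMeasure ≤
      |v s| * (couplingConst * (A * ‖f‖) * ∫ p, |w p| * ‖g p‖ ∂torusMeasure) := fun s => by
    have : ∫ p, ‖((couplingConst * v s : ℝ) : ℂ) * inner ℂ (phaseVector hw s) f *
        (phase p s * (w p : ℂ) * (starRingEnd ℂ) (g p))‖ ∂torusMeasure =
        couplingConst * |v s| * ‖inner ℂ (phaseVector hw s) f‖ *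
          ∫ p, |w p| * ‖g p‖ ∂torusMeasure := by
      rw [← integral_const_mul]
      refine integral_congr_ae (ae_of_all _ fun p => ?_)
      simp only [norm_mul, RCLike.norm_conj, norm_phase, Complex.norm_real, Real.norm_eq_abs,
        abs_of_nonneg couplingConst_nonneg]
      ring
    rw [this]
    have h1 := norm_inner_phaseVector_le hw s f
    have h2 : 0 ≤ ∫ p, |w p| * ‖g p‖ ∂torusMeasure :=
      integral_nonneg fun p => by positivity
    have h3 := couplingConst_nonneg
    calc couplingConst * |v s| * ‖inner ℂ (phaseVector hw s) f‖ *
          ∫ p, |w p| * ‖g p‖ ∂torusMeasure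
        ≤ couplingConst * |v s| * (A * ‖f‖) * ∫ p, |w p| * ‖g p‖ ∂torusMeasure := by gcongr
      _ = _ := by ring
  have h := hasSum_integral_of_summable_integral_norm hI
    (Summable.of_nonneg_of_le (fun s => integral_nonneg fun p => norm_nonneg _) hn
      (hv.mul_right _))
  refine hasSum_of_eq h (fun s => ?_) ?_
  · rw [integral_const_mul, hin]
    ring
  · rw [L2.inner_def]
    refine integral_congr_ae ?_
    filter_upwards [hT.hasSum_apply hv hw f] with p hp
    rw [RCLike.inner_apply, ← (hp.mul_right ((starRingEnd ℂ) (g p))).tsum_eq]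
    refine tsum_congr fun s => ?_
    ring

/-- The diagonal form is a weighted sum of squares with weights proportional to `v̂`. Positivity is
read off from it, and forms with different weights `w` are compared coefficient by coefficient. -/
lemma HasKernel.hasSum_re_inner_self {v : Site → ℝ} (hv : Summable fun s => |v s|)
    {w : Momentum → ℝ} (hw : MemLp w 2 torusMeasure) {T : L2Torus →L[ℂ] L2Torus}
    (hT : HasKernel T (weightedKernel v w)) (f : L2Torus) :
    HasSum (fun s => couplingConst * v s * ‖inner ℂ (phaseVector hw s) f‖ ^ 2)
      (inner ℂ f (T f)).re := by
  have h := Complex.hasSum_re (hT.hasSum_inner hv hw f f)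
  convert h using 1
  funext s
  rw [← inner_conj_symm f, Complex.mul_conj, Complex.re_ofReal_mul, Complex.ofReal_re,
    Complex.normSq_eq_norm_sq]

lemma HasKernel.isPositive_of_weightedKernel {v : Site → ℝ} (hv : Summable fun s => |v s|)
    (hv0 : ∀ s, 0 ≤ v s) {w : Momentum → ℝ} (hw : MemLp w 2 torusMeasure)
    {T : L2Torus →L[ℂ] L2Torus} (hT : HasKernel T (weightedKernel v w)) : T.IsPositive := by
  refine ⟨fun f g => ?_, fun f => ?_⟩
  · have h1 := hT.hasSum_inner hv hw g f
    have h2 := Complex.hasSum_conj'.2 (hT.hasSum_inner hv hw f g)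
    change inner ℂ (T f) g = inner ℂ f (T g)
    rw [← inner_conj_symm]
    refine HasSum.unique ?_ h1
    convert h2 using 1
    funext s
    simp only [map_mul, inner_conj_symm, Complex.conj_ofReal]
    ring
  · rw [ContinuousLinearMap.reApplyInnerSelf_apply, ← inner_conj_symm]
    simp only [RCLike.re_to_complex, Complex.conj_re]
    exact (hT.hasSum_re_inner_self hv hw f).nonneg fun s =>
      mul_nonneg (mul_nonneg couplingConst_nonneg (hv0 s)) (sq_nonneg _)

/-- The norm of `phaseVector hw s` does not depend on `s`, so summability of `v̂` gives convergence
in operator norm; matrix elements identify the limit as `T`. Norm convergence is what makes `T`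
compact, as a limit of finite-rank operators. -/
lemma HasKernel.hasSum_rankOne {v : Site → ℝ} (hv : Summable fun s => |v s|)
    {w : Momentum → ℝ} (hw : MemLp w 2 torusMeasure) {T : L2Torus →L[ℂ] L2Torus}
    (hT : HasKernel T (weightedKernel v w)) :
    HasSum (fun s => ((couplingConst * v s : ℝ) : ℂ) •
      InnerProductSpace.rankOne ℂ (phaseVector hw s) (phaseVector hw s)) T := by
  have hs : Summable (fun s => ((couplingConst * v s : ℝ) : ℂ) •
      InnerProductSpace.rankOne ℂ (phaseVector hw s) (phaseVector hw s)) := by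
    refine (hv.mul_right (couplingConst * (eLpNorm w 2 torusMeasure).toReal ^ 2)).of_norm_bounded
      fun s => le_of_eq ?_
    rw [norm_smul, InnerProductSpace.norm_rankOne, norm_phaseVector, Complex.norm_real,
      Real.norm_eq_abs, abs_mul, abs_of_nonneg couplingConst_nonneg]
    ring
  convert hs.hasSum using 1
  ext1 f
  refine ext_inner_left ℂ fun g => ?_
  have h1 := hT.hasSum_inner hv hw f g
  have h2 := ((innerSL ℂ g).hasSum ((ContinuousLinearMap.apply ℂ L2Torus f).hasSum hs.hasSum))
  refine HasSum.unique h1 ?_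
  refine hasSum_of_eq h2 (fun s => ?_) rfl
  simp

lemma HasKernel.isCompactOperator_of_weightedKernel {v : Site → ℝ}
    (hv : Summable fun s => |v s|) {w : Momentum → ℝ} (hw : MemLp w 2 torusMeasure)
    {T : L2Torus →L[ℂ] L2Torus} (hT : HasKernel T (weightedKernel v w)) : IsCompactOperator T := by
  refine isCompactOperator_of_tendsto (hT.hasSum_rankOne hv hw) (Eventually.of_forall fun s => ?_)
  change (∑ i ∈ s, _) ∈ compactOperator (RingHom.id ℂ) L2Torus L2Torus
  refine Submodule.sum_mem _ fun i _ => Submodule.smul_mem _ _ ?_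
  change IsCompactOperator _
  rw [InnerProductSpace.rankOne_def']
  have h : IsCompactOperator (ContinuousLinearMap.toSpanSingleton ℂ (phaseVector hw i)) :=
    isCompactOperator_of_locallyCompactSpace_rng _
  exact h.comp_clm (innerSL ℂ (phaseVector hw i))

/-! ### The Birman-Schwinger principle for form-bounded perturbations -/

section BirmanSchwinger

variable {H : Type*} [NormedAddCommGroup H] [InnerProductSpace ℂ H]

lemma re_inner_self_eq (f : H) : (inner ℂ f f).re = ‖f‖ ^ 2 :=
  inner_self_eq_norm_sq (𝕜 := ℂ) f

/-- A symmetric operator which is nonnegative on an invariant subspace satisfies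
`‖P f‖² ≤ (‖P‖ + 1) (P f, f)` there. -/
lemma norm_sq_le_of_nonneg_on {P : H →L[ℂ] H} (hP : (P : H →ₗ[ℂ] H).IsSymmetric)
    {M : Submodule ℂ H} (hinv : ∀ f ∈ M, P f ∈ M) (hpos : ∀ f ∈ M, 0 ≤ (inner ℂ (P f) f).re)
    {f : H} (hf : f ∈ M) : ‖P f‖ ^ 2 ≤ (‖P‖ + 1) * (inner ℂ (P f) f).re := by
  set t : ℝ := (‖P‖ + 1)⁻¹ with ht
  have hP0 := norm_nonneg P
  have ht0 : 0 < t := by positivity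
  -- Nonnegativity is tested on `f - t P f`, which stays in `M`. With this `t` the quadratic term is
  -- at most half of the linear one, leaving `t ‖P f‖² ≤ (P f, f)`.
  have h := hpos _ (M.sub_mem hf (M.smul_mem (t : ℂ) (hinv f hf)))
  have hsym : inner ℂ (P (P f)) f = inner ℂ (P f) (P f) := hP (P f) f
  have hexp : (inner ℂ (P (f - (t : ℂ) • P f)) (f - (t : ℂ) • P f)).re =
      (inner ℂ (P f) f).re - 2 * t * ‖P f‖ ^ 2 + t ^ 2 * (inner ℂ (P (P f)) (P f)).re := by
    simp only [map_sub, map_smul, inner_sub_left, inner_sub_right, inner_smul_left,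
      inner_smul_right, hsym, Complex.conj_ofReal]
    simp only [Complex.sub_re, Complex.re_ofReal_mul, re_inner_self_eq]
    ring
  have hle : (inner ℂ (P (P f)) (P f)).re ≤ ‖P‖ * ‖P f‖ ^ 2 := by
    refine (Complex.re_le_norm _).trans ((norm_inner_le_norm _ _).trans ?_)
    rw [sq, ← mul_assoc]
    exact mul_le_mul_of_nonneg_right (P.le_opNorm _) (norm_nonneg _)
  rw [hexp] at h
  have hprod : (‖P‖ + 1) * t = 1 := by rw [ht]; exact mul_inv_cancel₀ (by positivity)
  have h1 : t ^ 2 * (inner ℂ (P (P f)) (P f)).re ≤ t * ‖P f‖ ^ 2 := by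
    calc t ^ 2 * (inner ℂ (P (P f)) (P f)).re ≤ t ^ 2 * (‖P‖ * ‖P f‖ ^ 2) := by gcongr
      _ ≤ t ^ 2 * ((‖P‖ + 1) * ‖P f‖ ^ 2) := by gcongr; linarith
      _ = t * ((‖P‖ + 1) * t) * ‖P f‖ ^ 2 := by ring
      _ = _ := by rw [hprod, mul_one]
  have h2 : t * ‖P f‖ ^ 2 ≤ (inner ℂ (P f) f).re := by linarith
  calc ‖P f‖ ^ 2 = (‖P‖ + 1) * t * ‖P f‖ ^ 2 := by rw [hprod, one_mul]
    _ = (‖P‖ + 1) * (t * ‖P f‖ ^ 2) := by ring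
    _ ≤ _ := by gcongr

/-- Below the lower bound of `B`, the infimum of the form of a compact perturbation `B - V` on a
closed invariant subspace is an eigenvalue. -/
lemma exists_eigenvector_of_form_lt [CompleteSpace H] {B V : H →L[ℂ] H}
    (hA : ((B - V : H →L[ℂ] H) : H →ₗ[ℂ] H).IsSymmetric) (hV : IsCompactOperator V) {z : ℝ}
    (hB : ∀ f, z * ‖f‖ ^ 2 ≤ (inner ℂ (B f) f).re) {M : Submodule ℂ H}
    (hM : IsClosed (M : Set H)) (hinv : ∀ f ∈ M, (B - V) f ∈ M) {f₀ : H} (hf₀ : f₀ ∈ M)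
    (hlt : (inner ℂ ((B - V) f₀) f₀).re < z * ‖f₀‖ ^ 2) :
    ∃ t : ℝ, t < z ∧ ∃ f ∈ M, f ≠ 0 ∧ (B - V) f = (t : ℂ) • f := by
  set A := B - V with hAdef
  set S : Set ℝ := {x | ∃ f ∈ M, ‖f‖ = 1 ∧ (inner ℂ (A f) f).re = x} with hS
  have hscale : ∀ (c : ℝ) (f : H), (inner ℂ (A ((c : ℂ) • f)) ((c : ℂ) • f)).re =
      c ^ 2 * (inner ℂ (A f) f).re := fun c f => by
    rw [map_smul, inner_smul_left, inner_smul_right, Complex.conj_ofReal, ← mul_assoc,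
      ← Complex.ofReal_mul, Complex.re_ofReal_mul, sq]
  have hnormalize : ∀ f ∈ M, f ≠ 0 → (inner ℂ (A f) f).re / ‖f‖ ^ 2 ∈ S := fun f hf hf0 => by
    have hn : ‖f‖ ≠ 0 := norm_ne_zero_iff.2 hf0
    refine ⟨((‖f‖⁻¹ : ℝ) : ℂ) • f, M.smul_mem _ hf, ?_, ?_⟩
    · rw [norm_smul, Complex.norm_real, norm_inv, norm_norm, inv_mul_cancel₀ hn]
    · rw [hscale]
      field_simp
  have hbdd : BddBelow S := by
    refine ⟨-‖A‖, ?_⟩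
    rintro _ ⟨f, -, hf, rfl⟩
    have h1 := (Complex.abs_re_le_norm _).trans (norm_inner_le_norm (𝕜 := ℂ) (A f) f)
    have h2 := A.le_opNorm f
    rw [hf, mul_one] at h1 h2
    linarith [(abs_le.1 h1).1]
  have hf₀0 : f₀ ≠ 0 := by
    rintro rfl
    simp at hlt
  have hmem := hnormalize f₀ hf₀ hf₀0
  set t := sInf S with ht
  have htz : t < z := by
    refine (csInf_le hbdd hmem).trans_lt ?_
    rw [div_lt_iff₀ (by positivity)]
    exact hlt
  have hform : ∀ f ∈ M, t * ‖f‖ ^ 2 ≤ (inner ℂ (A f) f).re := fun f hf => by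
    rcases eq_or_ne f 0 with rfl | hf0
    · simp
    · have := csInf_le hbdd (hnormalize f hf hf0)
      rwa [le_div_iff₀ (by positivity)] at this
  set P : H →L[ℂ] H := A - (t : ℂ) • ContinuousLinearMap.id ℂ H with hP
  have hPf : ∀ f, P f = A f - (t : ℂ) • f := fun f => by simp [hP]
  have hPre : ∀ f, (inner ℂ (P f) f).re = (inner ℂ (A f) f).re - t * ‖f‖ ^ 2 := fun f => by
    rw [hPf, inner_sub_left, inner_smul_left, Complex.conj_ofReal, Complex.sub_re,
      Complex.re_ofReal_mul, re_inner_self_eq]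
  have hPsym : (P : H →ₗ[ℂ] H).IsSymmetric := fun f g => by
    have h := hA f g
    simp only [ContinuousLinearMap.coe_coe] at h ⊢
    rw [hPf, hPf, inner_sub_left, inner_sub_right, inner_smul_left, inner_smul_right,
      Complex.conj_ofReal, h]
  have hPinv : ∀ f ∈ M, P f ∈ M := fun f hf => by
    rw [hPf]
    exact M.sub_mem (hinv f hf) (M.smul_mem _ hf)
  have hPpos : ∀ f ∈ M, 0 ≤ (inner ℂ (P f) f).re := fun f hf => by
    rw [hPre]
    linarith [hform f hf]
  obtain ⟨x, -, hxt, hxS⟩ := exists_seq_tendsto_sInf ⟨_, hmem⟩ hbdd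
  choose u huM hu1 hux using hxS
  -- For a minimizing sequence the form of `P = A - t` tends to zero. As `P ≥ 0` on `M`, the bound
  -- `norm_sq_le_of_nonneg_on` upgrades this to norm convergence.
  have hPu : Tendsto (fun n => P (u n)) atTop (𝓝 0) := by
    rw [tendsto_zero_iff_norm_tendsto_zero]
    have h1 : Tendsto (fun n => (‖P‖ + 1) * (x n - t)) atTop (𝓝 0) := by
      have := (hxt.sub_const t).const_mul (‖P‖ + 1)
      rwa [sub_self, mul_zero] at this
    have h2 : Tendsto (fun n => ‖P (u n)‖ ^ 2) atTop (𝓝 0) := by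
      refine squeeze_zero (fun n => sq_nonneg _) (fun n => ?_) h1
      refine (norm_sq_le_of_nonneg_on hPsym hPinv hPpos (huM n)).trans_eq ?_
      rw [hPre, hux, hu1]
      ring
    have h3 := h2.sqrt
    simpa using h3
  obtain ⟨y, -, φ, hφ, hy⟩ := (hV.isCompact_closure_image_closedBall 1).tendsto_subseq
    (x := fun n => V (u n)) fun n => subset_closure ⟨u n, by simp [hu1 n], rfl⟩
  -- `Q = B - t` is bounded below by `z - t > 0`, hence has closed range and a bounded inverse on
  -- it. Since `Q u = P u + V u` converges along the subsequence, so does `u`.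
  set Q : H →L[ℂ] H := B - (t : ℂ) • ContinuousLinearMap.id ℂ H with hQ
  have hQf : ∀ f, Q f = B f - (t : ℂ) • f := fun f => by simp [hQ]
  have hQP : ∀ f, Q f = P f + V f := fun f => by
    rw [hQf, hPf, hAdef, sub_apply]
    abel
  have hQbound : ∀ f, (z - t) * ‖f‖ ≤ ‖Q f‖ := fun f => by
    rcases eq_or_ne f 0 with rfl | hf0
    · simp
    have hn : 0 < ‖f‖ := norm_pos_iff.2 hf0
    refine le_of_mul_le_mul_right ?_ hn
    refine le_trans ?_ ((Complex.re_le_norm _).trans (norm_inner_le_norm (𝕜 := ℂ) (Q f) f))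
    rw [hQf, inner_sub_left, inner_smul_left, Complex.conj_ofReal, Complex.sub_re,
      Complex.re_ofReal_mul, re_inner_self_eq]
    have := hB f
    nlinarith
  have hzt : 0 < z - t := sub_pos.2 htz
  have hanti : AntilipschitzWith (Real.toNNReal (z - t)⁻¹) Q :=
    Q.antilipschitz_of_bound fun f => by
      rw [Real.coe_toNNReal _ (inv_nonneg.2 hzt.le), inv_mul_eq_div, le_div_iff₀ hzt, mul_comm]
      exact hQbound f
  have hQu : Tendsto (fun n => Q (u (φ n))) atTop (𝓝 y) := by
    have := (hPu.comp hφ.tendsto_atTop).add hy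
    simpa [hQP, Function.comp_def] using this
  obtain ⟨f, hf⟩ : y ∈ Set.range Q := by
    refine (hanti.isClosed_range Q.uniformContinuous).mem_of_tendsto hQu ?_
    exact Eventually.of_forall fun n => ⟨_, rfl⟩
  have huf : Tendsto (fun n => u (φ n)) atTop (𝓝 f) := by
    rw [tendsto_iff_norm_sub_tendsto_zero]
    have h1 : Tendsto (fun n => (z - t)⁻¹ * ‖Q (u (φ n)) - y‖) atTop (𝓝 0) := by
      have := (tendsto_iff_norm_sub_tendsto_zero.1 hQu).const_mul (z - t)⁻¹
      rwa [mul_zero] at this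
    refine squeeze_zero (fun n => norm_nonneg _) (fun n => ?_) h1
    rw [inv_mul_eq_div, le_div_iff₀ hzt, mul_comm, ← hf, ← map_sub]
    exact hQbound _
  have hf1 : ‖f‖ = 1 := by
    refine tendsto_nhds_unique huf.norm ?_
    simp only [hu1]
    exact tendsto_const_nhds
  have hPf0 : P f = 0 :=
    tendsto_nhds_unique ((P.continuous.tendsto f).comp huf) (hPu.comp hφ.tendsto_atTop)
  refine ⟨t, htz, f, hM.mem_of_tendsto huf (Eventually.of_forall fun n => huM _), ?_, ?_⟩
  · rw [← norm_ne_zero_iff, hf1]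
    exact one_ne_zero
  · rwa [hPf, sub_eq_zero] at hPf0

/-- Positivity of a quadratic form on a finite dimensional space can be transported to the range
of an operator with dense range. -/
lemma exists_form_pos_of_denseRange {Q R : H →L[ℂ] H} (hR : DenseRange R) {ι : Type*} [Fintype ι]
    {u : ι → H} (hu : ∀ x : ι → ℂ, x ≠ 0 →
      0 < (inner ℂ (Q (∑ i, x i • u i)) (∑ i, x i • u i)).re) :
    ∃ g : ι → H, ∀ x : ι → ℂ, x ≠ 0 →
      0 < (inner ℂ (Q (R (∑ i, x i • g i))) (R (∑ i, x i • g i))).re := by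
  -- Since the unit sphere of coefficients is compact, positivity on the span is an open condition
  -- on the tuple. A tuple in the range of `R` can therefore be chosen close to `u`, and homogeneity
  -- recovers all nonzero coefficients.
  have hopen : ∀ᶠ y : ι → H in 𝓝 u, ∀ x ∈ Metric.sphere (0 : ι → ℂ) 1,
      0 < (inner ℂ (Q (∑ i, x i • y i)) (∑ i, x i • y i)).re := by
    refine (isCompact_sphere (0 : ι → ℂ) 1).eventually_forall_of_forall_eventually fun x hx => ?_
    have hc : Continuous fun p : (ι → H) × (ι → ℂ) =>
        (inner ℂ (Q (∑ i, p.2 i • p.1 i)) (∑ i, p.2 i • p.1 i)).re := by fun_prop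
    refine hc.continuousAt.eventually (lt_mem_nhds (hu x ?_))
    rintro rfl
    simp at hx
  obtain ⟨g, hy⟩ := (DenseRange.piMap fun _ : ι => hR).mem_nhds hopen
  refine ⟨g, fun x hx => ?_⟩
  have hn : 0 < ‖x‖ := norm_pos_iff.2 hx
  have h := hy (((‖x‖⁻¹ : ℝ) : ℂ) • x) (by
    rw [mem_sphere_zero_iff_norm, norm_smul, Complex.norm_real, norm_inv, norm_norm,
      inv_mul_cancel₀ hn.ne'])
  have hsum : ∑ i, (((‖x‖⁻¹ : ℝ) : ℂ) • x) i • Pi.map (fun _ => R) g i =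
      ((‖x‖⁻¹ : ℝ) : ℂ) • R (∑ i, x i • g i) := by
    simp [Finset.smul_sum, smul_smul]
  rw [hsum, map_smul, inner_smul_left, inner_smul_right, Complex.conj_ofReal, ← mul_assoc,
    ← Complex.ofReal_mul, Complex.re_ofReal_mul] at h
  exact pos_of_mul_pos_right h (by positivity)

/-- The sum of the eigenspaces below `z`. -/
def lowEigenspace (A : H →L[ℂ] H) (z : ℝ) : Submodule ℂ H :=
  ⨆ t : Set.Iio z, Module.End.eigenspace (A : Module.End ℂ H) ((t : ℝ) : ℂ)

lemma apply_mem_lowEigenspace {A : H →L[ℂ] H} {z : ℝ} {f : H} (hf : f ∈ lowEigenspace A z) :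
    A f ∈ lowEigenspace A z := by
  refine Submodule.iSup_induction _ (motive := fun f => A f ∈ lowEigenspace A z) hf
    (fun t f hf => ?_) (by simp) fun f g hf hg => ?_
  · have h : A f = ((t : ℝ) : ℂ) • f := Module.End.mem_eigenspace_iff.1 hf
    rw [h]
    exact Submodule.smul_mem _ _ (Submodule.mem_iSup_of_mem t hf)
  · rw [map_add]
    exact Submodule.add_mem _ hf hg

/-- Eigenspaces for distinct eigenvalues are orthogonal, so the form is a finite sum of terms `t ‖u
t‖²` with `t < z`. The inequality stays strict because some component is nonzero. -/
lemma form_lt_of_mem_lowEigenspace {A : H →L[ℂ] H} (hA : (A : H →ₗ[ℂ] H).IsSymmetric) {z : ℝ}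
    {f : H} (hf : f ∈ lowEigenspace A z) (hf0 : f ≠ 0) :
    (inner ℂ (A f) f).re < z * ‖f‖ ^ 2 := by
  have horth := hA.orthogonalFamily_eigenspaces.comp
    (γ := Set.Iio z) (f := fun t => ((t : ℝ) : ℂ))
    (fun s t h => Subtype.ext (Complex.ofReal_injective h))
  obtain ⟨u, hu, rfl⟩ := (Submodule.mem_iSup_iff_exists_finsupp _ f).1 hf
  have hAu : ∀ t, A (u t) = ((t : ℝ) : ℂ) • u t := fun t =>
    Module.End.mem_eigenspace_iff.1 (hu t)
  have h1 := horth.inner_sum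
    (fun t => ((t : ℝ) : ℂ) • (⟨u t, hu t⟩ : Module.End.eigenspace (A : Module.End ℂ H) _))
    (fun t => ⟨u t, hu t⟩) u.support
  have h2 := horth.inner_sum (fun t => ⟨u t, hu t⟩) (fun t => ⟨u t, hu t⟩) u.support
  simp only [map_smul, Submodule.coe_subtypeₗᵢ, Submodule.subtype_apply, inner_smul_left, Submodule.coe_inner,
    Complex.conj_ofReal] at h1 h2
  rw [Finsupp.sum, map_sum]
  simp only [hAu]
  rw [h1, ← inner_self_eq_norm_sq (𝕜 := ℂ), h2]
  simp only [RCLike.re_to_complex, Complex.re_sum, Complex.re_ofReal_mul, Finset.mul_sum]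
  have hpos : ∀ t ∈ u.support, 0 < (inner ℂ (u t) (u t)).re := fun t ht => by
    rw [← RCLike.re_to_complex, inner_self_eq_norm_sq]
    have := norm_pos_iff.2 (Finsupp.mem_support_iff.1 ht)
    positivity
  refine Finset.sum_lt_sum_of_nonempty ?_ fun t ht => mul_lt_mul_of_pos_right t.2 (hpos t ht)
  rw [Finset.nonempty_iff_ne_empty]
  intro h
  rw [Finsupp.support_eq_empty] at h
  simp [h] at hf0

/-- The Birman-Schwinger principle: if `B ≥ z`, `V` is compact, and `R` is an injective operator
with dense range such that `B - V - z = R* (1 - G) R` as forms, then the number of eigenvalues of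
`B - V` below `z` is `n(1, G)`. -/
theorem eigenvalueCount_eq_formCount [CompleteSpace H] {B V R G : H →L[ℂ] H}
    (hA : ((B - V : H →L[ℂ] H) : H →ₗ[ℂ] H).IsSymmetric) (hV : IsCompactOperator V) {z : ℝ}
    (hB : ∀ f, z * ‖f‖ ^ 2 ≤ (inner ℂ (B f) f).re) (hRinj : Function.Injective R)
    (hR : DenseRange R)
    (hform : ∀ f, (inner ℂ ((B - V) f) f).re - z * ‖f‖ ^ 2 =
      ‖R f‖ ^ 2 - (inner ℂ (G (R f)) (R f)).re) :
    eigenvalueCount (B - V) z = formCount 1 G := by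
  set W := lowEigenspace (B - V) z with hW
  change Cardinal.toENat (Module.rank ℂ W) = _
  refine le_antisymm ?_ (iSup_le fun L => ?_)
  · have hL : ∀ g ∈ W.map (R : H →ₗ[ℂ] H), g ≠ 0 → 1 * ‖g‖ ^ 2 < (inner ℂ (G g) g).re := by
      rintro _ ⟨f, hf, rfl⟩ hg
      have hf0 : f ≠ 0 := by
        rintro rfl
        simp at hg
      have h1 := form_lt_of_mem_lowEigenspace hA hf hf0
      have h2 := hform f
      simp only [ContinuousLinearMap.coe_coe]
      linarith
    have hrank : Module.rank ℂ W = Module.rank ℂ (W.map (R : H →ₗ[ℂ] H)) :=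
      (Submodule.equivMapOfInjective (R : H →ₗ[ℂ] H) hRinj W).rank_eq
    rw [hrank]
    exact le_iSup (fun L : {L : Submodule ℂ H // ∀ f ∈ L, f ≠ 0 →
      1 * ‖f‖ ^ 2 < (inner ℂ (G f) f).re} => Cardinal.toENat (Module.rank ℂ L.1)) ⟨_, hL⟩
  -- If `L` were larger than `W`, then `W` would be finite dimensional, and `L` would contain one
  -- more independent vector than `dim W`.
  · by_contra! hlt
    have hWfin : Module.rank ℂ W < Cardinal.aleph0 :=
      Cardinal.toENat_lt_top.1 (hlt.trans_le le_top)
    have : FiniteDimensional ℂ W := Module.rank_lt_aleph0_iff.1 hWfin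
    set n := Module.finrank ℂ W with hn
    have hWn : Module.rank ℂ W = n := (Module.finrank_eq_rank ℂ W).symm
    have hLn : ((n + 1 : ℕ) : Cardinal) ≤ Module.rank ℂ L.1 := by
      rw [hWn, Cardinal.toENat_nat] at hlt
      have := Order.add_one_le_of_lt hlt
      rw [← Cardinal.natCast_le_toENat]
      exact_mod_cast this
    obtain ⟨s, hs, hsli⟩ := le_rank_iff_exists_linearIndependent_finset.1 hLn
    have hu : ∀ x : s → ℂ, x ≠ 0 → 0 < (inner ℂ
        ((G - ContinuousLinearMap.id ℂ H) (∑ i, x i • ((i : L.1) : H)))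
        (∑ i, x i • ((i : L.1) : H))).re := fun x hx => by
      set f : L.1 := ∑ i, x i • (i : L.1) with hf
      have hfc : ∑ i, x i • ((i : L.1) : H) = (f : H) := by simp [hf]
      have hf0 : f ≠ 0 := fun h0 =>
        hx (funext fun i => Fintype.linearIndependent_iff.1 hsli x h0 i)
      have := L.2 f f.2 (by simpa using hf0)
      rw [hfc, sub_apply, inner_sub_left, Complex.sub_re, ContinuousLinearMap.id_apply,
        re_inner_self_eq]
      linarith
    -- `L` need not meet the range of `R`, so its vectors are first replaced by nearby ones of the
    -- form `R (g i)`.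
    obtain ⟨g, hg⟩ := exists_form_pos_of_denseRange hR hu
    let Φ : (s → ℂ) →ₗ[ℂ] W :=
      (W.orthogonalProjectionOnto : H →ₗ[ℂ] W) ∘ₗ Fintype.linearCombination ℂ g
    -- There are `n + 1` coefficients and `W` has dimension `n`, so some nontrivial combination of
    -- the `g i` is orthogonal to `W`.
    have hker : LinearMap.ker Φ ≠ ⊥ := by
      refine LinearMap.ker_ne_bot_of_finrank_lt ?_
      rw [Module.finrank_fintype_fun_eq_card, Fintype.card_coe, hs]
      exact Nat.lt_succ_self n
    obtain ⟨x, hx, hx0⟩ := Submodule.exists_mem_ne_zero_of_ne_bot hker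
    set f : H := ∑ i, x i • g i with hf
    have hfW : f ∈ Wᗮ := by
      have : W.orthogonalProjectionOnto f = 0 := hx
      rwa [Submodule.orthogonalProjectionOnto_eq_zero_iff] at this
    have hneg : (inner ℂ ((B - V) f) f).re < z * ‖f‖ ^ 2 := by
      have h1 := hg x hx0
      have h2 := hform f
      rw [sub_apply, inner_sub_left, Complex.sub_re, ContinuousLinearMap.id_apply,
        re_inner_self_eq, ← hf] at h1
      linarith
    have hinv : ∀ f ∈ Wᗮ, (B - V) f ∈ Wᗮ := fun f hf => by
      rw [Submodule.mem_orthogonal] at hf ⊢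
      intro w hw
      have h : inner ℂ ((B - V) w) f = inner ℂ w ((B - V) f) := hA w f
      rw [← h]
      exact hf _ (apply_mem_lowEigenspace hw)
    obtain ⟨t, ht, h, hhW, hh0, hh⟩ := exists_eigenvector_of_form_lt hA hV hB
      W.isClosed_orthogonal hinv hfW hneg
    have hhW' : h ∈ W :=
      Submodule.mem_iSup_of_mem (⟨t, ht⟩ : Set.Iio z) (Module.End.mem_eigenspace_iff.2 hh)
    exact hh0 (inner_self_eq_zero.1 (Submodule.inner_right_of_mem_orthogonal hhW' hhW))

end BirmanSchwinger

/-! ### Multiplication operators -/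

lemma measurableSet_torus : MeasurableSet torus := MeasurableSet.univ_pi fun _ => measurableSet_Ioc

lemma ae_mem_torus : ∀ᵐ q ∂torusMeasure, q ∈ torus := ae_restrict_mem measurableSet_torus

lemma memLp_top_of_continuous {m : Momentum → ℝ} (hm : Continuous m) :
    MemLp (fun q => (m q : ℂ)) ∞ torusMeasure := by
  obtain ⟨C, hC⟩ := (isCompact_closedBall (0 : Momentum) Real.pi).exists_bound_of_continuousOn
    hm.continuousOn
  refine memLp_top_of_bound (Complex.continuous_ofReal.comp hm).aestronglyMeasurable C ?_
  filter_upwards [ae_mem_torus] with q hq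
  rw [Complex.norm_real]
  exact hC q (by simpa using norm_le_of_mem_torus hq)

lemma isSymmetric_multiplicationOperator {m : Momentum → ℝ}
    (hm : MemLp (fun q => (m q : ℂ)) ∞ torusMeasure) :
    (multiplicationOperator (fun q => (m q : ℂ)) : L2Torus →ₗ[ℂ] L2Torus).IsSymmetric :=
  fun f g => by
    simp only [ContinuousLinearMap.coe_coe]
    rw [L2.inner_def, L2.inner_def]
    refine integral_congr_ae ?_
    filter_upwards [multiplicationOperator_ae hm f, multiplicationOperator_ae hm g] with q h1 h2
    rw [h1, h2]
    simp only [RCLike.inner_apply, map_mul, Complex.conj_ofReal]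
    ring

lemma injective_multiplicationOperator {m : Momentum → ℂ} (hm : MemLp m ∞ torusMeasure)
    (hm0 : ∀ᵐ q ∂torusMeasure, m q ≠ 0) : Function.Injective (multiplicationOperator m) := by
  rw [injective_iff_map_eq_zero]
  intro f hf
  rw [Lp.eq_zero_iff_ae_eq_zero] at hf ⊢
  filter_upwards [hf, multiplicationOperator_ae hm f, hm0] with q h1 h2 h3
  rw [h2] at h1
  exact (mul_eq_zero.1 h1).resolve_left h3

/-- The orthogonal complement of the range of a bounded symmetric operator is its kernel. -/
lemma denseRange_of_isSymmetric_of_injective {H : Type*} [NormedAddCommGroup H]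
    [InnerProductSpace ℂ H] [CompleteSpace H] {R : H →L[ℂ] H}
    (hR : (R : H →ₗ[ℂ] H).IsSymmetric) (hinj : Function.Injective R) : DenseRange R := by
  have h : (LinearMap.range (R : H →ₗ[ℂ] H)).topologicalClosure = ⊤ := by
    rw [Submodule.topologicalClosure_eq_top_iff, Submodule.eq_bot_iff]
    intro f hf
    rw [Submodule.mem_orthogonal] at hf
    refine hinj ?_
    rw [map_zero]
    refine ext_inner_left ℂ fun g => ?_
    rw [inner_zero_right]
    exact (hR g f).symm.trans (hf _ ⟨g, rfl⟩)
  rw [DenseRange, dense_iff_closure_eq]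
  exact congrArg (fun S : Submodule ℂ H => (S : Set H)) h

/-! ### Inverse square roots of symbols with a nondegenerate minimum -/

/-- The weight `(E - z)^{-1/2}`. -/
def resolventWeight (E : Momentum → ℝ) (z : ℝ) (q : Momentum) : ℝ := (√(E q - z))⁻¹

/-- The identity holds at every point: where a square root vanishes, division by zero makes both
sides zero. -/
lemma birmanSchwingerKernel_eq (e v : Fin 3 → Site → ℝ) (α : Fin 3) (k : Momentum) (z : ℝ) :
    birmanSchwingerKernel e v α k z =
      weightedKernel (v α) (resolventWeight (pairEnergy e α k) z) := by
  funext p q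
  simp only [birmanSchwingerKernel, weightedKernel, interactionKernel, resolventWeight]
  push_cast
  rw [div_eq_mul_inv, mul_inv]

section Weight

variable {E : Momentum → ℝ} {θ c : ℝ} {a : Momentum}

lemma ae_ne_torusMeasure (a : Momentum) : ∀ᵐ q ∂torusMeasure, q ≠ a :=
  ae_restrict_of_ae (Measure.ae_ne volume a)

lemma ae_lt_of_quadratic_lower_bound (hc : 0 < c)
    (hE : ∀ q ∈ torus, θ + c * ‖q - a‖ ^ 2 ≤ E q) : ∀ᵐ q ∂torusMeasure, θ < E q := by
  filter_upwards [ae_mem_torus, ae_ne_torusMeasure a] with q hq hqa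
  have h := norm_pos_iff.2 (sub_ne_zero.2 hqa)
  have : 0 < c * ‖q - a‖ ^ 2 := by positivity
  linarith [hE q hq]

lemma continuous_sqrt_sub (hEc : Continuous E) (z : ℝ) : Continuous fun q => √(E q - z) := by
  fun_prop

lemma measurable_resolventWeight (hEc : Continuous E) (z : ℝ) : Measurable (resolventWeight E z) :=
  (continuous_sqrt_sub hEc z).measurable.inv

lemma resolventWeight_nonneg (z : ℝ) (q : Momentum) : 0 ≤ resolventWeight E z q :=
  inv_nonneg.2 (Real.sqrt_nonneg _)

/-- The weights below the threshold are dominated by `c^{-1/2} ‖q - a‖⁻¹`. -/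
lemma ae_resolventWeight_le (hc : 0 < c) (hE : ∀ q ∈ torus, θ + c * ‖q - a‖ ^ 2 ≤ E q) :
    ∀ᵐ q ∂torusMeasure, ∀ z ≤ θ, resolventWeight E z q ≤ (√(c * ‖q - a‖ ^ 2))⁻¹ := by
  filter_upwards [ae_mem_torus, ae_ne_torusMeasure a] with q hq hqa z hz
  have h := norm_pos_iff.2 (sub_ne_zero.2 hqa)
  refine inv_anti₀ (by positivity) (Real.sqrt_le_sqrt ?_)
  linarith [hE q hq]

lemma memLp_inv_sqrt (hc : 0 < c) (a : Momentum) :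
    MemLp (fun q => (√(c * ‖q - a‖ ^ 2))⁻¹) 2 torusMeasure := by
  rw [memLp_two_iff_integrable_sq]
  · refine ((integrable_inv_sq_norm_sub a).const_mul c⁻¹).congr (ae_of_all _ fun q => ?_)
    simp only
    rw [inv_pow, Real.sq_sqrt (by positivity), mul_inv]
  · have : Continuous fun q : Momentum => √(c * ‖q - a‖ ^ 2) := by fun_prop
    exact this.measurable.inv.aestronglyMeasurable

/-- The endpoint `z = θ` is included, since the majorant `c^{-1/2} ‖q - a‖⁻¹` does not depend on `z`
and is square integrable in dimension three. -/
lemma memLp_resolventWeight (hEc : Continuous E) (hc : 0 < c)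
    (hE : ∀ q ∈ torus, θ + c * ‖q - a‖ ^ 2 ≤ E q) {z : ℝ} (hz : z ≤ θ) :
    MemLp (resolventWeight E z) 2 torusMeasure := by
  refine (memLp_inv_sqrt hc a).of_le (measurable_resolventWeight hEc z).aestronglyMeasurable ?_
  filter_upwards [ae_resolventWeight_le hc hE] with q hq
  rw [Real.norm_of_nonneg (resolventWeight_nonneg z q), Real.norm_of_nonneg (by positivity)]
  exact hq z hz

/-- Dominated convergence with a majorant independent of `z`, namely twice the tensor square of the
bound for the weights. Pointwise convergence can fail only where a coordinate is `a`, a null set;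
elsewhere `E > θ ≥ z₀` and the weight is continuous at `z₀`. -/
lemma tendsto_eLpNorm_tensor_sub (hEc : Continuous E) (hc : 0 < c)
    (hE : ∀ q ∈ torus, θ + c * ‖q - a‖ ^ 2 ≤ E q) {z₀ : ℝ} (hz₀ : z₀ ≤ θ) :
    Tendsto (fun z => eLpNorm (fun x : Momentum × Momentum =>
        resolventWeight E z x.1 * resolventWeight E z x.2 -
          resolventWeight E z₀ x.1 * resolventWeight E z₀ x.2) 2
        (torusMeasure.prod torusMeasure)) (𝓝[Set.Iic θ] z₀) (𝓝 0) := by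
  set μ := torusMeasure.prod torusMeasure
  set b : Momentum → ℝ := fun q => (√(c * ‖q - a‖ ^ 2))⁻¹ with hb
  have hsq : ∀ {g : Momentum × Momentum → ℝ}, eLpNorm g 2 μ ^ 2 = ∫⁻ x, ‖g x‖ₑ ^ 2 ∂μ :=
    fun {g} => by
      simpa using eLpNorm_nnreal_pow_eq_lintegral (μ := μ) (f := g) (p := 2) two_ne_zero
  have hfst : ∀ {P : Momentum → Prop}, (∀ᵐ q ∂torusMeasure, P q) → ∀ᵐ x ∂μ, P x.1 := fun h =>
    Measure.quasiMeasurePreserving_fst.ae h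
  have hsnd : ∀ {P : Momentum → Prop}, (∀ᵐ q ∂torusMeasure, P q) → ∀ᵐ x ∂μ, P x.2 := fun h =>
    Measure.quasiMeasurePreserving_snd.ae h
  have hbb : MemLp (fun x : Momentum × Momentum => 2 * (b x.1 * b x.2)) 2 μ :=
    (memLp_tensor (memLp_inv_sqrt hc a) (memLp_inv_sqrt hc a)).const_mul 2
  have hmeas : ∀ z, Measurable fun x : Momentum × Momentum =>
      resolventWeight E z x.1 * resolventWeight E z x.2 := fun z =>
    ((measurable_resolventWeight hEc z).comp measurable_fst).mul
      ((measurable_resolventWeight hEc z).comp measurable_snd)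
  have hlim : Tendsto (fun z => ∫⁻ x, ‖resolventWeight E z x.1 * resolventWeight E z x.2 -
      resolventWeight E z₀ x.1 * resolventWeight E z₀ x.2‖ₑ ^ 2 ∂μ) (𝓝[Set.Iic θ] z₀)
      (𝓝 (∫⁻ _, 0 ∂μ)) := by
    refine tendsto_lintegral_filter_of_dominated_convergence
      (fun x => ‖2 * (b x.1 * b x.2)‖ₑ ^ 2)
      (Eventually.of_forall fun z => ((hmeas z).sub (hmeas z₀)).enorm.pow_const 2) ?_ ?_ ?_
    · filter_upwards [self_mem_nhdsWithin] with z hz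
      filter_upwards [hfst (ae_resolventWeight_le hc hE), hsnd (ae_resolventWeight_le hc hE)]
        with x h1 h2
      gcongr
      rw [enorm_le_iff_norm_le, Real.norm_of_nonneg (by positivity : 0 ≤ 2 * (b x.1 * b x.2))]
      have hprod : ∀ y ≤ θ, 0 ≤ resolventWeight E y x.1 * resolventWeight E y x.2 ∧
          resolventWeight E y x.1 * resolventWeight E y x.2 ≤ b x.1 * b x.2 := fun y hy =>
        ⟨mul_nonneg (resolventWeight_nonneg _ _) (resolventWeight_nonneg _ _),
          mul_le_mul (h1 y hy) (h2 y hy) (resolventWeight_nonneg _ _)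
            (inv_nonneg.2 (Real.sqrt_nonneg _))⟩
      have ha := hprod z hz
      have hb := hprod z₀ hz₀
      rw [Real.norm_eq_abs, abs_le]
      constructor <;> linarith [ha.1, ha.2, hb.1, hb.2]
    · rw [← hsq]
      exact ENNReal.pow_ne_top hbb.eLpNorm_ne_top
    · have hae := ae_lt_of_quadratic_lower_bound hc hE
      filter_upwards [hfst hae, hsnd hae] with x h1 h2
      have hcont : ∀ q, θ < E q → ContinuousAt (fun z => resolventWeight E z q) z₀ := fun q hq => by
        unfold resolventWeight
        refine ContinuousAt.inv₀ (by fun_prop) ?_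
        exact (Real.sqrt_pos.2 (by linarith)).ne'
      have h3 : Tendsto (fun z => resolventWeight E z x.1 * resolventWeight E z x.2 -
          resolventWeight E z₀ x.1 * resolventWeight E z₀ x.2) (𝓝[Set.Iic θ] z₀) (𝓝 0) := by
        have := ((hcont _ h1).tendsto.mul (hcont _ h2).tendsto).sub_const
          (resolventWeight E z₀ x.1 * resolventWeight E z₀ x.2)
        rw [sub_self] at this
        exact this.mono_left nhdsWithin_le_nhds
      have h4 := ENNReal.Tendsto.pow (n := 2) h3.enorm
      simpa using h4
  simp only [← hsq, lintegral_zero] at hlim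
  -- The limit was obtained for the square of the norm; the power `1/2` undoes the square.
  have h := (ENNReal.continuous_rpow_const (y := 2⁻¹)).tendsto 0 |>.comp hlim
  rw [ENNReal.zero_rpow_of_pos (by norm_num)] at h
  refine h.congr fun z => ?_
  rw [Function.comp_apply, ← ENNReal.rpow_natCast, ← ENNReal.rpow_mul]
  norm_num

lemma tendsto_eLpNorm_weightedKernel_sub {v : Site → ℝ} (hv : Summable fun s => |v s|)
    (hEc : Continuous E) (hc : 0 < c) (hE : ∀ q ∈ torus, θ + c * ‖q - a‖ ^ 2 ≤ E q) {z₀ : ℝ}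
    (hz₀ : z₀ ≤ θ) :
    Tendsto (fun z => eLpNorm (Function.uncurry fun p q =>
        weightedKernel v (resolventWeight E z) p q - weightedKernel v (resolventWeight E z₀) p q) 2
        (torusMeasure.prod torusMeasure)) (𝓝[Set.Iic θ] z₀) (𝓝 0) := by
  set M := couplingConst * ∑' s, |v s|
  have h := ENNReal.Tendsto.const_mul (a := ENNReal.ofReal M)
    (tendsto_eLpNorm_tensor_sub hEc hc hE hz₀) (Or.inr ENNReal.ofReal_ne_top)
  rw [mul_zero] at h
  refine tendsto_of_tendsto_of_tendsto_of_le_of_le tendsto_const_nhds h (fun z => zero_le)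
    fun z => ?_
  refine eLpNorm_le_mul_eLpNorm_of_ae_le_mul (ae_of_all _ fun x => ?_) 2
  simp only [Function.uncurry, weightedKernel]
  rw [← mul_sub, ← Complex.ofReal_sub, norm_mul, Complex.norm_real]
  exact mul_le_mul_of_nonneg_right (norm_interactionKernel_le hv _ _) (norm_nonneg _)

end Weight

/-! ### The Birman-Schwinger principle at and below the threshold -/

/-- Both the operator norm and the Hilbert–Schmidt norm of `G z - G z₀` are bounded by the `L²` norm
of the difference of the kernels. -/
lemma HasKernel.continuousOn_of_weightedKernel {v : Site → ℝ} (hv : Summable fun s => |v s|)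
    {E : Momentum → ℝ} {θ c : ℝ} {a : Momentum} (hEc : Continuous E) (hc : 0 < c)
    (hE : ∀ q ∈ torus, θ + c * ‖q - a‖ ^ 2 ≤ E q) {G : ℝ → L2Torus →L[ℂ] L2Torus}
    (hG : ∀ z ≤ θ, HasKernel (G z) (weightedKernel v (resolventWeight E z))) :
    ContinuousOn G (Set.Iic θ) ∧ HSContinuousOn G (Set.Iic θ) := by
  have hmem : ∀ z ≤ θ, ∀ z₀ ≤ θ, MemLp (Function.uncurry fun p q =>
      weightedKernel v (resolventWeight E z) p q - weightedKernel v (resolventWeight E z₀) p q) 2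
      (torusMeasure.prod torusMeasure) := fun z hz z₀ hz₀ =>
    (memLp_weightedKernel hv (memLp_resolventWeight hEc hc hE hz)).sub
      (memLp_weightedKernel hv (memLp_resolventWeight hEc hc hE hz₀))
  refine ⟨fun z₀ hz₀ => ?_, fun ι b z₀ hz₀ => ?_⟩
  · rw [ContinuousWithinAt, tendsto_iff_edist_tendsto_0]
    refine tendsto_of_tendsto_of_tendsto_of_le_of_le' tendsto_const_nhds
      (tendsto_eLpNorm_weightedKernel_sub hv hEc hc hE hz₀) (Eventually.of_forall fun z => zero_le)
      ?_
    filter_upwards [self_mem_nhdsWithin] with z hz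
    rw [edist_eq_enorm_sub]
    exact ((hG z hz).sub (hG z₀ hz₀)).enorm_le (hmem z hz z₀ hz₀)
  · have h := ENNReal.Tendsto.pow (n := 2) (tendsto_eLpNorm_weightedKernel_sub hv hEc hc hE hz₀)
    rw [zero_pow two_ne_zero] at h
    refine tendsto_of_tendsto_of_tendsto_of_le_of_le' tendsto_const_nhds h
      (Eventually.of_forall fun z => zero_le) ?_
    filter_upwards [self_mem_nhdsWithin] with z hz
    exact ((hG z hz).sub (hG z₀ hz₀)).tsum_enorm_sq_le (hmem z hz z₀ hz₀) b.orthonormal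

/-- The interaction is the case of constant weight, so the plane-wave expansion, positivity and
compactness apply to it as well. -/
lemma weightedKernel_one (v : Site → ℝ) : weightedKernel v (fun _ => 1) = interactionKernel v := by
  funext p q
  simp [weightedKernel]

/-- Passing from `f` to `√(E - z) f` removes the weights. -/
lemma re_inner_weighted_multiplication {v : Site → ℝ} (hv : Summable fun s => |v s|)
    {u w : Momentum → ℝ} (hu : MemLp (fun q => (u q : ℂ)) ∞ torusMeasure)
    (hw : MemLp w 2 torusMeasure) (huw : ∀ᵐ q ∂torusMeasure, w q * u q = 1)
    {V G : L2Torus →L[ℂ] L2Torus} (hV : HasKernel V (interactionKernel v))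
    (hG : HasKernel G (weightedKernel v w)) (f : L2Torus) :
    (inner ℂ (G (multiplicationOperator (fun q => (u q : ℂ)) f))
      (multiplicationOperator (fun q => (u q : ℂ)) f)).re = (inner ℂ (V f) f).re := by
  have h1 : MemLp (fun _ : Momentum => (1 : ℝ)) 2 torusMeasure := memLp_const 1
  rw [← weightedKernel_one] at hV
  have hre : ∀ g h : L2Torus, (inner ℂ g h).re = (inner ℂ h g).re := fun g h =>
    inner_re_symm (𝕜 := ℂ) g h
  rw [hre, hre (V f)]
  refine (hG.hasSum_re_inner_self hv hw _).unique
    (hasSum_of_eq (hV.hasSum_re_inner_self hv h1 f) (fun s => ?_) rfl)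
  congr 3
  -- The two series agree termwise: in each coefficient the weight `w` cancels the factor `u` almost
  -- everywhere.
  rw [inner_phaseVector, inner_phaseVector]
  refine integral_congr_ae ?_
  filter_upwards [huw, multiplicationOperator_ae hu f] with q h2 h3
  rw [h3]
  have h4 : (w q : ℂ) * (u q : ℂ) = 1 := by exact_mod_cast h2
  calc (starRingEnd ℂ) (phase q s) * (w q : ℂ) * ((u q : ℂ) * f q)
      = (starRingEnd ℂ) (phase q s) * ((w q : ℂ) * (u q : ℂ)) * f q := by ring
    _ = _ := by rw [h4, Complex.ofReal_one]

/-- The abstract principle applies with `R` the multiplication by `√(E - z)`, for which `B = z +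
R²`. The root vanishes at most on a null set, even at `z = θ`, so `R` is injective; being symmetric,
it has dense range. -/
lemma eigenvalueCount_eq_formCount_of_quadratic_lower_bound {v : Site → ℝ}
    (hv : Summable fun s => |v s|) (hv0 : ∀ s, 0 ≤ v s) {E : Momentum → ℝ} {θ c : ℝ}
    {a : Momentum} (hEc : Continuous E) (hc : 0 < c)
    (hE : ∀ q ∈ torus, θ + c * ‖q - a‖ ^ 2 ≤ E q) {z : ℝ} (hz : z ≤ θ)
    {V G : L2Torus →L[ℂ] L2Torus} (hV : HasKernel V (interactionKernel v))
    (hG : HasKernel G (weightedKernel v (resolventWeight E z))) :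
    eigenvalueCount (multiplicationOperator (fun q => (E q : ℂ)) - V) z = formCount 1 G := by
  have h1 : MemLp (fun _ : Momentum => (1 : ℝ)) 2 torusMeasure := memLp_const 1
  have hV1 : HasKernel V (weightedKernel v fun _ => 1) := by rwa [weightedKernel_one]
  have hEm := memLp_top_of_continuous hEc
  have hum := memLp_top_of_continuous (continuous_sqrt_sub hEc z)
  set B := multiplicationOperator (fun q => (E q : ℂ)) with hBdef
  set R := multiplicationOperator (fun q => (√(E q - z) : ℂ)) with hRdef
  have hpos : ∀ᵐ q ∂torusMeasure, 0 < √(E q - z) :=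
    (ae_lt_of_quadratic_lower_bound hc hE).mono fun q hq => Real.sqrt_pos.2 (by linarith)
  have hRsym : (R : L2Torus →ₗ[ℂ] L2Torus).IsSymmetric := isSymmetric_multiplicationOperator hum
  have hRinj : Function.Injective R := injective_multiplicationOperator hum
    (hpos.mono fun q hq => by exact_mod_cast hq.ne')
  have hBR : ∀ f, B f = (z : ℂ) • f + R (R f) := fun f => by
    refine Lp.ext ?_
    filter_upwards [multiplicationOperator_ae hEm f, multiplicationOperator_ae hum f,
      multiplicationOperator_ae hum (R f), Lp.coeFn_add ((z : ℂ) • f) (R (R f)),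
      Lp.coeFn_smul (z : ℂ) f, hpos] with q a1 a2 a3 a4 a5 a6
    rw [a1, a4, Pi.add_apply, a5, a3, a2, Pi.smul_apply, smul_eq_mul, ← mul_assoc,
      ← Complex.ofReal_mul, Real.mul_self_sqrt (Real.sqrt_pos.1 a6).le]
    push_cast
    ring
  have hBform : ∀ f, (inner ℂ (B f) f).re = z * ‖f‖ ^ 2 + ‖R f‖ ^ 2 := fun f => by
    have : inner ℂ (R (R f)) f = inner ℂ (R f) (R f) := hRsym (R f) f
    rw [hBR, inner_add_left, inner_smul_left, Complex.conj_ofReal, Complex.add_re,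
      Complex.re_ofReal_mul, re_inner_self_eq, this, re_inner_self_eq]
  refine eigenvalueCount_eq_formCount (R := R) ?_
    (hV1.isCompactOperator_of_weightedKernel hv h1) (fun f => ?_) hRinj
    (denseRange_of_isSymmetric_of_injective hRsym hRinj) fun f => ?_
  · exact (isSymmetric_multiplicationOperator hEm).sub
      (hV1.isPositive_of_weightedKernel hv hv0 h1).1
  · rw [hBform]
    linarith [sq_nonneg ‖R f‖]
  · rw [sub_apply, inner_sub_left, Complex.sub_re, hBform, hRdef,
      re_inner_weighted_multiplication hv hum (memLp_resolventWeight hEc hc hE hz) ?_ hV hG f]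
    · ring
    · exact hpos.mono fun q hq => inv_mul_cancel₀ hq.ne'

/-- The estimates above use the sup norm of `k`, which the Euclidean norm dominates. -/
lemma norm_lt_of_sqrt_sum_sq_lt {k : Momentum} {δ : ℝ} (h : √(∑ i, k i ^ 2) < δ) : ‖k‖ < δ := by
  refine (pi_norm_lt_iff ((Real.sqrt_nonneg _).trans_lt h)).2 fun i => lt_of_le_of_lt ?_ h
  rw [Real.norm_eq_abs]
  exact Real.abs_le_sqrt
    (Finset.single_le_sum (f := fun i => k i ^ 2) (fun _ _ => sq_nonneg _) (Finset.mem_univ i))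

end LatticeSchrodinger

end

theorem theorem5p4 (e v : Fin 3 → LatticeSchrodinger.Site → ℝ)
    (he : ∀ α, LatticeSchrodinger.IsDispersion (e α))
    (hv : ∀ α, LatticeSchrodinger.IsPairPotential (v α)) (α : Fin 3) :
    ∃ δ : ℝ, 0 < δ ∧ ∀ k ∈ LatticeSchrodinger.torus, √(∑ i, k i ^ 2) < δ →
      (∀ z ≤ LatticeSchrodinger.thresholdEnergy e α k,
        LatticeSchrodinger.HasKernel
          (LatticeSchrodinger.birmanSchwingerOperator e v α k z)
          (LatticeSchrodinger.birmanSchwingerKernel e v α k z) ∧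
        (LatticeSchrodinger.birmanSchwingerOperator e v α k z).IsPositive ∧
        LatticeSchrodinger.IsHilbertSchmidt
          (LatticeSchrodinger.birmanSchwingerOperator e v α k z)) ∧
      ContinuousOn (fun z => LatticeSchrodinger.birmanSchwingerOperator e v α k z)
        (Set.Iic (LatticeSchrodinger.thresholdEnergy e α k)) ∧
      LatticeSchrodinger.HSContinuousOn
        (fun z => LatticeSchrodinger.birmanSchwingerOperator e v α k z)
        (Set.Iic (LatticeSchrodinger.thresholdEnergy e α k)) ∧
      ∀ z ≤ LatticeSchrodinger.thresholdEnergy e α k,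
        LatticeSchrodinger.eigenvalueCount
            (LatticeSchrodinger.twoParticleOperator e v α k) z =
          LatticeSchrodinger.formCount 1
            (LatticeSchrodinger.birmanSchwingerOperator e v α k z) := by
  open LatticeSchrodinger in
  obtain ⟨δ, hδ, hδk⟩ := exists_quadratic_lower_bound he α
  refine ⟨δ, hδ, fun k _ hk => ?_⟩
  obtain ⟨a, c, hc, hE⟩ := hδk k (norm_lt_of_sqrt_sum_sq_lt hk)
  have hEc := continuous_pairEnergy he α k
  have hvs := (hv α).summable
  have hw := fun z (hz : z ≤ thresholdEnergy e α k) => memLp_resolventWeight hEc hc hE hz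
  have hG : ∀ z ≤ thresholdEnergy e α k, HasKernel (birmanSchwingerOperator e v α k z)
      (weightedKernel (v α) (resolventWeight (pairEnergy e α k) z)) := fun z hz => by
    rw [birmanSchwingerOperator, birmanSchwingerKernel_eq]
    exact integralOperator_hasKernel (memLp_weightedKernel hvs (hw z hz))
  have hV : HasKernel (integralOperator (interactionKernel (v α))) (interactionKernel (v α)) := by
    refine integralOperator_hasKernel ?_
    rw [← weightedKernel_one]
    exact memLp_weightedKernel hvs (memLp_const 1)
  have hcont := HasKernel.continuousOn_of_weightedKernel hvs hEc hc hE hG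
  refine ⟨fun z hz => ⟨?_, ?_, ?_⟩, hcont.1, hcont.2, fun z hz => ?_⟩
  · rw [birmanSchwingerKernel_eq]
    exact hG z hz
  · exact (hG z hz).isPositive_of_weightedKernel hvs (hv α).nonneg (hw z hz)
  · exact (hG z hz).isHilbertSchmidt (memLp_weightedKernel hvs (hw z hz))
  · exact eigenvalueCount_eq_formCount_of_quadratic_lower_bound hvs (hv α).nonneg hEc hc hE hz hV
      (hG z hz)
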